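/- **Theorem 4.2.** Let $\mathbb S^n$ be the space of real symmetric $n\times n$ matrices with the usual order and the operator norm $\|\cdot\|$. Let $0<\lambda\le\Lambda$, $\mu>0$, $0<\beta\le 1$, let $\Omega\subset\mathbb R^n$ be a bounded open set, and let $F:\Omega\times\mathbb R\times\mathbb R^n\times\mathbb S^n\to\mathbb R$ satisfy, for all $x,y\in\Omega$, $z,w\in\mathbb R$, $p,q\in\mathbb R^n$, $X,Y\in\mathbb S^n$: (2.2) $\lambda\,\mathrm{Tr}(X-Y)\le F(x,z,p,Y)-F(x,z,p,X)\le\Lambda\,\mathrm{Tr}(X-Y)$ whenever $X\ge Y$; (2.3) $F(x,z,p,X)\le F(x,w,p,X)$ whenever $z\le w$; (2.4) $\displaystyle |F(x,z,p,X)-F(y,z,q,X)|\le \mu\Big[|x-y|(1+|p|+|q|)+\frac{|p-q|}{1+|p|+|q|}\Big]^{\beta}\big(1+|p|^2+|q|^2+\|X\|\big).$ Let $u\in C(\Omega)$ be a viscosity solution of $F(x,u,\nabla u,\nabla^2u)=0$ in $\Omega$, that is, for every $\phi\in C^2(\Omega)$ one has $F(x_0,u(x_0),\nabla\phi(x_0),\nabla^2\phi(x_0))\le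 0$ at each local maximum point $x_0\in\Omega$ of $u-\phi$, and $\ge 0$ at each local minimum point $x_0\in\Omega$ of $u-\phi$. Then $u$ is locally Lipschitz continuous in $\Omega$. If moreover $u$ is bounded, then $$|u(x)-u(y)|\le\frac{C}{d}\,|x-y|\qquad\text{for all }x,y\in\Omega,$$ where $d=\min\{d(x,\partial\Omega),d(y,\partial\Omega)\}$ and $C>0$ depends only on $n,\lambda,\Lambda,\mu,\beta$ and upper bounds for $\sup_\Omega|u|$ and $\operatorname{diam}\Omega$. -/

import Mathlib

noncomputable section

namespace FullyNonlinear

/-- Euclidean space `ℝⁿ`. -/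
abbrev Eucl (n : ℕ) : Type := EuclideanSpace ℝ (Fin n)

/-- A nonlinearity `F(x, z, p, X)`. Only its values for `x` in the domain at hand and for symmetric
`X` are ever used, so a total function on all matrices represents a function on
`Ω × ℝ × ℝⁿ × 𝕊ⁿ`. -/
abbrev Nonlinearity (n : ℕ) : Type :=
  Eucl n → ℝ → Eucl n → Matrix (Fin n) (Fin n) ℝ → ℝ

/-- The Euclidean operator (spectral) norm of a square matrix. -/
def opNorm {n : ℕ} (X : Matrix (Fin n) (Fin n) ℝ) : ℝ :=
  ‖Matrix.toEuclideanCLM (𝕜 := ℝ) (n := Fin n) X‖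

/-- Uniform ellipticity with constants `lam ≤ Lam`: for symmetric `X ≥ Y`,
`lam * Tr (X - Y) ≤ F(x,z,p,Y) - F(x,z,p,X) ≤ Lam * Tr (X - Y)`. -/
def UniformlyElliptic {n : ℕ} (Ω : Set (Eucl n)) (F : Nonlinearity n) (lam Lam : ℝ) : Prop :=
  ∀ x ∈ Ω, ∀ (z : ℝ) (p : Eucl n) (X Y : Matrix (Fin n) (Fin n) ℝ),
    X.IsSymm → Y.IsSymm → (X - Y).PosSemidef →
      lam * (X - Y).trace ≤ F x z p Y - F x z p X ∧
      F x z p Y - F x z p X ≤ Lam * (X - Y).trace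

/-- `F` is nondecreasing in `z`. -/
def MonotoneInValue {n : ℕ} (Ω : Set (Eucl n)) (F : Nonlinearity n) : Prop :=
  ∀ x ∈ Ω, ∀ (z w : ℝ) (p : Eucl n) (X : Matrix (Fin n) (Fin n) ℝ),
    X.IsSymm → z ≤ w → F x z p X - F x w p X ≤ 0

/-- The natural structure condition of fractional order `β`, with constant `mu`. -/
def NaturalStructure {n : ℕ} (Ω : Set (Eucl n)) (F : Nonlinearity n) (mu β : ℝ) : Prop :=
  ∀ x ∈ Ω, ∀ y ∈ Ω, ∀ (z : ℝ) (p q : Eucl n) (X : Matrix (Fin n) (Fin n) ℝ), X.IsSymm →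
    |F x z p X - F y z q X| ≤
      mu * (‖x - y‖ * (1 + ‖p‖ + ‖q‖) + ‖p - q‖ / (1 + ‖p‖ + ‖q‖)) ^ β
        * (1 + ‖p‖ ^ 2 + ‖q‖ ^ 2 + opNorm X)

/-- The Hessian matrix `(∂ᵢ ∂ⱼ φ (x))ᵢⱼ`. -/
def hessian {n : ℕ} (φ : Eucl n → ℝ) (x : Eucl n) : Matrix (Fin n) (Fin n) ℝ :=
  Matrix.of fun i j =>
    fderiv ℝ (fderiv ℝ φ) x (EuclideanSpace.single i 1) (EuclideanSpace.single j 1)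

/-- Viscosity subsolutions of `F(x, u, ∇u, ∇²u) = 0` in the open set `Ω`. -/
def IsViscositySubsolution {n : ℕ} (Ω : Set (Eucl n)) (F : Nonlinearity n) (u : Eucl n → ℝ) :
    Prop :=
  UpperSemicontinuousOn u Ω ∧
    ∀ φ : Eucl n → ℝ, ContDiffOn ℝ 2 φ Ω →
      ∀ x₀ ∈ Ω, IsLocalMaxOn (fun x => u x - φ x) Ω x₀ →
        F x₀ (u x₀) (gradient φ x₀) (hessian φ x₀) ≤ 0

/-- Viscosity supersolutions of `F(x, u, ∇u, ∇²u) = 0` in the open set `Ω`. -/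
def IsViscositySupersolution {n : ℕ} (Ω : Set (Eucl n)) (F : Nonlinearity n) (u : Eucl n → ℝ) :
    Prop :=
  LowerSemicontinuousOn u Ω ∧
    ∀ φ : Eucl n → ℝ, ContDiffOn ℝ 2 φ Ω →
      ∀ x₀ ∈ Ω, IsLocalMinOn (fun x => u x - φ x) Ω x₀ →
        0 ≤ F x₀ (u x₀) (gradient φ x₀) (hessian φ x₀)

/-- Viscosity solutions: continuous functions that are both sub- and supersolutions. -/
def IsViscositySolution {n : ℕ} (Ω : Set (Eucl n)) (F : Nonlinearity n) (u : Eucl n → ℝ) : Prop :=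
  ContinuousOn u Ω ∧ IsViscositySubsolution Ω F u ∧ IsViscositySupersolution Ω F u

/-- `min (d(x, ∂Ω), d(y, ∂Ω))`. -/
def boundaryDist {n : ℕ} (Ω : Set (Eucl n)) (x y : Eucl n) : ℝ :=
  min (Metric.infDist x (frontier Ω)) (Metric.infDist y (frontier Ω))

end FullyNonlinear

end

/-! The proof is the Ishii–Lions doubling method. Suppose u(x₀) - u(y) exceeds a concave modulus
φ(|x₀ - y|). Then u(ξ) - u(η) - φ(|ξ - η|) - K|ξ - x₀|² has a positive interior maximum. With e the
direction of ξ - η, r = |ξ - η|, P = φ'(r) and w = 2K|ξ - x₀|, the theorem on sums gives a superjet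
at ξ and a subjet at η. Their gradients are about Pe + 2K(ξ - x₀) and Pe, and their Hessians satisfy
X ≤ Y + O(K). Along e, X lies below Y by a further amount b of the size of -φ''. Ellipticity turns b
into a gain λb, while the structure condition bounds the cost of moving from ξ to η. Writing b =
σP/r and dividing by P/r leaves (`doubling_inequality_scaled`) λσ ≤ C·Kr/P + C(4rP + w/P)^β (1 +
rP). A modulus that violates this inequality is therefore an upper bound for the oscillation
(`sub_le_modulus`).

Two moduli are used. For φ = 2M(r/r₁)^α one has σ = 1 - α, while the right side tends to 0 with α;
this gives a Hölder bound. For φ = θ(2ρ - ρ^(1+γ)), ρ = r/r₁, σ is only of order ρ^γ, so the right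
side must decay as fast. Here the Hölder bound is used: positivity at the maximum gives K|ξ - x₀|² <
u(ξ) - u(η) ≤ θρ^α, so w/P is of order ρ^(α/2), and γ = αβ/2 makes the two sides comparable. The
remaining coefficients are small once the scale τ is small.

The theorem on sums is proved in approximate form, which suffices because only bounds pass to the
limit. It combines sup-convolution with Jensen's argument: a semiconvex function has second-order
expansions arbitrarily near a maximum, since the contact points of slightly tilted maxima form a set
of positive measure. -/

open Set Filter Topology MeasureTheory Metric
open scoped NNReal ENNReal RealInnerProductSpace

/-! ### Second-order expansions of convex functions touched from above by paraboloids. -/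

section SecondOrder

variable {E : Type*} [NormedAddCommGroup E] [InnerProductSpace ℝ E]

/-- The paraboloid with vertex `z`, slope `b` and opening `C` touches `g` from above at `z`. -/
def TouchesAbove (g : E → ℝ) (C : ℝ) (z b : E) : Prop :=
  ∀ z', g z' ≤ g z + ⟪b, z' - z⟫ + C * ‖z' - z‖ ^ 2

/-- The point z is a convex combination of z' and the reflected point z - t(z' - z). The paraboloid
bounds g at the latter, and after division by t its quadratic error is O(t). -/
theorem TouchesAbove.subgradient {g : E → ℝ} {C : ℝ} {z b : E} (h : TouchesAbove g C z b)
    (hg : ConvexOn ℝ univ g) (hC : 0 < C) (z' : E) : g z + ⟪b, z' - z⟫ ≤ g z' := by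
  set k := z' - z with hk
  have key : ∀ t : ℝ, 0 < t → g z + ⟪b, k⟫ ≤ g z' + t * (C * ‖k‖ ^ 2) := by
    intro t ht
    have h1 := hg.2 (mem_univ z') (mem_univ (z - t • k)) 
      (by positivity : 0 ≤ t / (1 + t)) (by positivity : 0 ≤ 1 / (1 + t)) (by field_simp; ring)
    have h2 : (t / (1 + t)) • z' + (1 / (1 + t)) • (z - t • k) = z := by
      have : z' = z + k := by rw [hk]; abel
      rw [this]
      have h3 : (t / (1 + t)) + 1 / (1 + t) = 1 := by field_simp; ring
      have h4 : (t / (1 + t)) - 1 / (1 + t) * t = 0 := by field_simp; ring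
      calc _ = (t / (1 + t) + 1 / (1 + t)) • z + (t / (1 + t) - 1 / (1 + t) * t) • k := by module
        _ = z := by rw [h3, h4]; simp
    rw [h2] at h1
    have h3 := h (z - t • k)
    have h4 : z - t • k - z = (-t) • k := by module
    rw [h4, inner_smul_right, norm_smul, Real.norm_eq_abs, mul_pow, sq_abs] at h3
    simp only [smul_eq_mul] at h1
    have h5 : (1 + t) * g z ≤ t * g z' + g (z - t • k) := by
      calc (1 + t) * g z ≤ (1 + t) * (t / (1 + t) * g z' + 1 / (1 + t) * g (z - t • k)) := by
            gcongr
        _ = _ := by field_simp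
    have h6 : t * (g z + ⟪b, k⟫) ≤ t * (g z' + t * (C * ‖k‖ ^ 2)) := by nlinarith
    exact le_of_mul_le_mul_left h6 ht
  refine le_of_forall_pos_le_add fun ε hε => ?_
  have hpos : 0 < C * ‖k‖ ^ 2 + 1 := by positivity
  refine (key (ε / (C * ‖k‖ ^ 2 + 1)) (by positivity)).trans ?_
  gcongr
  rw [div_mul_eq_mul_div, div_le_iff₀ hpos]
  nlinarith

/-- The supporting plane at z₁ and the paraboloid at z₂ are compared at z₂ + k; k = (b₁ - b₂)/(2C)
is the optimal displacement. -/
theorem TouchesAbove.norm_slope_sub_le {g : E → ℝ} {C : ℝ} {z₁ z₂ b₁ b₂ : E}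
    (h₁ : TouchesAbove g C z₁ b₁) (h₂ : TouchesAbove g C z₂ b₂)
    (hg : ConvexOn ℝ univ g) (hC : 0 < C) : ‖b₁ - b₂‖ ≤ 2 * C * ‖z₁ - z₂‖ := by
  set k := (1 / (2 * C)) • (b₁ - b₂) with hk
  have e1 := h₁.subgradient hg hC (z₂ + k)
  have e2 := h₂ (z₂ + k)
  have e3 := h₁ z₂
  rw [add_sub_cancel_left] at e2
  have e4 : z₂ + k - z₁ = (z₂ - z₁) + k := by abel
  rw [e4, inner_add_right] at e1
  have e5 : ⟪b₁ - b₂, k⟫ ≤ C * ‖k‖ ^ 2 + C * ‖z₁ - z₂‖ ^ 2 := by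
    rw [inner_sub_left, norm_sub_rev z₁ z₂]; linarith
  rw [hk, inner_smul_right, real_inner_self_eq_norm_sq, norm_smul, Real.norm_eq_abs, mul_pow,
    sq_abs] at e5
  have e6 : ‖b₁ - b₂‖ ^ 2 ≤ (2 * C * ‖z₁ - z₂‖) ^ 2 := by
    field_simp at e5
    nlinarith
  exact (pow_le_pow_iff_left₀ (norm_nonneg _) (by positivity) two_ne_zero).1 e6

/-- The second-order expansion of `g` at `z` with gradient `b` and Hessian `T`. -/
def HasSecondOrderExpansion (g : E → ℝ) (z b : E) (T : E →L[ℝ] E) : Prop :=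
  ∀ ε > 0, ∀ᶠ h in 𝓝 (0 : E),
    |g (z + h) - g z - ⟪b, h⟫ - 1 / 2 * ⟪T h, h⟫| ≤ ε * ‖h‖ ^ 2

theorem abs_sub_le_of_forall_step {χ : ℕ → ℝ} {e : ℝ} (N : ℕ)
    (h : ∀ i < N, |χ (i + 1) - χ i| ≤ e) : |χ N - χ 0| ≤ N * e := by
  induction N with
  | zero => simp
  | succ N ih =>
    have h1 := ih fun i hi => h i (hi.trans (Nat.lt_succ_self N))
    have h2 := h N (Nat.lt_succ_self N)
    have h3 : χ (N + 1) - χ 0 = (χ (N + 1) - χ N) + (χ N - χ 0) := by ring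
    rw [h3]
    refine (abs_add_le _ _).trans ?_
    push_cast
    linarith

/-- One step of length η along the ray z + th. A contact point within η‖h‖ controls the increment up
to O(η²‖h‖²), small enough to be summed over 1/η steps. -/
theorem TouchesAbove.abs_increment_le {g : E → ℝ} {C : ℝ} {ζ b' : E} (hζ : TouchesAbove g C ζ b')
    (hg : ConvexOn ℝ univ g) (hC : 0 < C) {z β h : E} {T : E →L[ℝ] E} {t η : ℝ} (hη0 : 0 < η)
    (hn : ‖ζ - (z + t • h)‖ ≤ η * ‖h‖) (hb' : ‖b' - β - t • T h‖ ≤ η * ((2 + ‖T‖) * ‖h‖)) :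
    |g (z + (t + η) • h) - g (z + t • h) - η * ⟪β, h⟫ - ((t + η) ^ 2 - t ^ 2) / 2 * ⟪T h, h⟫|
      ≤ η ^ 2 * ((4 * C + 2 + 2 * ‖T‖) * ‖h‖ ^ 2) := by
  have hinner : |⟪b', h⟫ - ⟪β, h⟫ - t * ⟪T h, h⟫| ≤ η * ((2 + ‖T‖) * ‖h‖ ^ 2) := by
    have : ⟪b', h⟫ - ⟪β, h⟫ - t * ⟪T h, h⟫ = ⟪b' - β - t • T h, h⟫ := by
      rw [inner_sub_left, inner_sub_left, real_inner_smul_left]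
    rw [this]
    refine (abs_real_inner_le_norm _ _).trans ?_
    calc _ ≤ η * ((2 + ‖T‖) * ‖h‖) * ‖h‖ := by gcongr
      _ = _ := by ring
  have hTh : |⟪T h, h⟫| ≤ ‖T‖ * ‖h‖ ^ 2 := by
    refine (abs_real_inner_le_norm _ _).trans ?_
    calc _ ≤ ‖T‖ * ‖h‖ * ‖h‖ := by gcongr; exact T.le_opNorm h
      _ = _ := by ring
  have u1 := hζ (z + (t + η) • h)
  have l1 := hζ.subgradient hg hC (z + (t + η) • h)
  have u2 := hζ (z + t • h)
  have l2 := hζ.subgradient hg hC (z + t • h)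
  have r1 : z + (t + η) • h - ζ = (z + t • h - ζ) + η • h := by module
  have n1 : ‖z + t • h - ζ‖ ≤ η * ‖h‖ := by rw [norm_sub_rev]; exact hn
  have n2 : ‖(z + t • h - ζ) + η • h‖ ≤ 2 * η * ‖h‖ := by
    refine (norm_add_le _ _).trans ?_
    rw [norm_smul, Real.norm_eq_abs, abs_of_pos hη0]; linarith
  rw [r1, inner_add_right, inner_smul_right] at u1 l1
  have q1 : C * ‖(z + t • h - ζ) + η • h‖ ^ 2 ≤ C * (2 * η * ‖h‖) ^ 2 := by gcongr
  have q2 : C * ‖z + t • h - ζ‖ ^ 2 ≤ C * (η * ‖h‖) ^ 2 := by gcongr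
  have q3 : C * (η * ‖h‖) ^ 2 ≤ C * (2 * η * ‖h‖) ^ 2 := by
    gcongr; nlinarith [norm_nonneg h]
  have hmain : |g (z + (t + η) • h) - g (z + t • h) - η * ⟪b', h⟫| ≤ C * (2 * η * ‖h‖) ^ 2 := by
    rw [abs_le]; constructor <;> linarith
  have hdiff : g (z + (t + η) • h) - g (z + t • h) - η * ⟪β, h⟫ - ((t + η) ^ 2 - t ^ 2) / 2 * ⟪T h, h⟫
      = (g (z + (t + η) • h) - g (z + t • h) - η * ⟪b', h⟫)
      + η * (⟪b', h⟫ - ⟪β, h⟫ - t * ⟪T h, h⟫) - η ^ 2 / 2 * ⟪T h, h⟫ := by ring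
  rw [hdiff]
  refine (abs_sub _ _).trans ?_
  refine (add_le_add_left (abs_add_le _ _) _).trans ?_
  rw [abs_mul η, abs_of_pos hη0, abs_mul (η ^ 2 / 2), abs_of_pos (by positivity : 0 < η ^ 2 / 2)]
  have s1 : η * |⟪b', h⟫ - ⟪β, h⟫ - t * ⟪T h, h⟫| ≤ η * (η * ((2 + ‖T‖) * ‖h‖ ^ 2)) := by
    gcongr
  have s2 : η ^ 2 / 2 * |⟪T h, h⟫| ≤ η ^ 2 / 2 * (‖T‖ * ‖h‖ ^ 2) := by gcongr
  have s3 : 0 ≤ η ^ 2 * (‖T‖ * ‖h‖ ^ 2) := by positivity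
  have s4 : η ^ 2 * ((4 * C + 2 + 2 * ‖T‖) * ‖h‖ ^ 2) = C * (2 * η * ‖h‖) ^ 2
      + η * (η * ((2 + ‖T‖) * ‖h‖ ^ 2)) + η ^ 2 * (‖T‖ * ‖h‖ ^ 2) := by ring
  linarith

/-- The first-order expansion of the slope b on K is integrated along the segment from z to z + h by
a Riemann sum. Hypothesis `hd` supplies a point of K near each node. -/
theorem hasSecondOrderExpansion_of_touchesAbove {g : E → ℝ} {C : ℝ} {K : Set E} {b : E → E}
    (hg : ConvexOn ℝ univ g) (hC : 0 < C) (hK : ∀ z ∈ K, TouchesAbove g C z (b z))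
    {z : E} {T : E →L[ℝ] E} (hT : HasFDerivWithinAt b T K z)
    (hd : ∀ η > 0, ∀ᶠ h in 𝓝 (0 : E), ∃ ζ ∈ K, ‖ζ - (z + h)‖ ≤ η * ‖h‖) :
    HasSecondOrderExpansion g z (b z) T := by
  intro ε hε
  set A := 4 * C + 2 + 2 * ‖T‖ with hA
  have hApos : 0 < A := by positivity
  obtain ⟨m, hm⟩ := exists_nat_gt (A / ε)
  set N := m + 1 with hN
  set η : ℝ := 1 / (N : ℝ) with hη
  have hN0 : (0 : ℝ) < N := by rw [hN]; positivity
  have hη0 : 0 < η := by positivity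
  have hη1 : η ≤ 1 := by
    rw [hη, div_le_one hN0, hN]; push_cast; linarith [Nat.cast_nonneg (α := ℝ) m]
  have hηA : η * A ≤ ε := by
    rw [hη, div_mul_eq_mul_div, one_mul, div_le_iff₀ hN0]
    rw [div_lt_iff₀ hε] at hm
    rw [hN]; push_cast; nlinarith
  obtain ⟨δ₁, hδ₁, H₁⟩ := Metric.eventually_nhds_iff.1 (hd η hη0)
  have hT' := hT.isLittleO.bound hη0
  rw [eventually_nhdsWithin_iff] at hT'
  obtain ⟨δ₂, hδ₂, H₂⟩ := Metric.eventually_nhds_iff.1 hT'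
  refine Metric.eventually_nhds_iff.2 ⟨min δ₁ (δ₂ / 2), by positivity, fun {h} hh => ?_⟩
  rw [dist_zero_right] at hh
  have hh1 := hh.trans_le (min_le_left _ _)
  have hh2 := hh.trans_le (min_le_right _ _)
  -- Up to the constant `g z`, this is the Taylor error at the i-th node. Its N increments add up to
  -- at most N·η²A‖h‖² = ηA‖h‖² ≤ ε‖h‖².
  set χ : ℕ → ℝ := fun i => g (z + ((i : ℝ) * η) • h) - ((i : ℝ) * η) * ⟪b z, h⟫
    - ((i : ℝ) * η) ^ 2 / 2 * ⟪T h, h⟫ with hχ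
  have hstep : ∀ i < N, |χ (i + 1) - χ i| ≤ η ^ 2 * (A * ‖h‖ ^ 2) := by
    intro i hi
    set t : ℝ := (i : ℝ) * η with ht
    have ht0 : 0 ≤ t := by positivity
    have ht1 : t ≤ 1 := by
      rw [ht, hη, mul_one_div, div_le_one hN0]; exact_mod_cast hi.le
    have hth : ‖t • h‖ ≤ ‖h‖ := by
      rw [norm_smul, Real.norm_eq_abs, abs_of_nonneg ht0]
      exact mul_le_of_le_one_left (norm_nonneg _) ht1
    obtain ⟨ζ, hζK, hζ⟩ := H₁ (y := t • h) (by rw [dist_zero_right]; exact hth.trans_lt hh1)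
    have hζ' : ‖ζ - (z + t • h)‖ ≤ η * ‖h‖ := hζ.trans (by gcongr)
    have hζz : ‖ζ - z‖ ≤ 2 * ‖h‖ := by
      have : ζ - z = (ζ - (z + t • h)) + t • h := by abel
      rw [this]
      refine (norm_add_le _ _).trans ?_
      nlinarith [norm_nonneg h]
    have hb := H₂ (y := ζ) (by rw [dist_eq_norm]; linarith) hζK
    have hb' : ‖b ζ - b z - t • T h‖ ≤ η * ((2 + ‖T‖) * ‖h‖) := by
      have : b ζ - b z - t • T h = (b ζ - b z - T (ζ - z)) + T (ζ - (z + t • h)) := by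
        simp only [map_sub, map_add, map_smul]; abel
      rw [this]
      refine (norm_add_le _ _).trans ?_
      have e1 := T.le_opNorm (ζ - (z + t • h))
      have e2 : ‖T‖ * ‖ζ - (z + t • h)‖ ≤ ‖T‖ * (η * ‖h‖) := by gcongr
      have e3 : η * ‖ζ - z‖ ≤ η * (2 * ‖h‖) := by gcongr
      linarith
    have hcast : ((i + 1 : ℕ) : ℝ) * η = t + η := by push_cast; ring
    have hdiff : χ (i + 1) - χ i = g (z + (t + η) • h) - g (z + t • h) - η * ⟪b z, h⟫
        - ((t + η) ^ 2 - t ^ 2) / 2 * ⟪T h, h⟫ := by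
      simp only [hχ]; rw [hcast]; ring
    rw [hdiff]
    exact (hK ζ hζK).abs_increment_le hg hC hη0 hζ' hb'
  have hfin := abs_sub_le_of_forall_step N hstep
  have hNη : (N : ℝ) * η = 1 := by rw [hη]; field_simp
  have e0 : χ N - χ 0 = g (z + h) - g z - ⟪b z, h⟫ - 1 / 2 * ⟪T h, h⟫ := by
    simp only [hχ]; rw [hNη]; simp; ring
  rw [← e0]
  refine hfin.trans ?_
  have : (N : ℝ) * (η ^ 2 * (A * ‖h‖ ^ 2)) = ((N : ℝ) * η) * (η * A) * ‖h‖ ^ 2 := by ring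
  rw [this, hNη, one_mul]
  gcongr

variable [FiniteDimensional ℝ E] [MeasurableSpace E] [BorelSpace E]

/-- The slope map is Lipschitz on K, so by Rademacher it is differentiable within K almost
everywhere there. Almost every point of K is also a density point, near which K has no holes of
fixed relative size. -/
theorem exists_hasSecondOrderExpansion {g : E → ℝ} {C : ℝ} {K : Set E} {b : E → E}
    (hg : ConvexOn ℝ univ g) (hC : 0 < C) (hK : ∀ z ∈ K, TouchesAbove g C z (b z))
    (μ : Measure E) [μ.IsAddHaarMeasure] (hμ : μ K ≠ 0) :
    ∃ z ∈ K, ∃ T : E →L[ℝ] E, HasSecondOrderExpansion g z (b z) T := by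
  have hlip : LipschitzOnWith (Real.toNNReal (2 * C)) b K := by
    refine LipschitzOnWith.of_dist_le_mul fun x hx y hy => ?_
    rw [dist_eq_norm, dist_eq_norm, Real.coe_toNNReal _ (by positivity)]
    exact (hK x hx).norm_slope_sub_le (hK y hy) hg hC
  have h1 := hlip.ae_differentiableWithinAt_of_mem (μ := μ)
  have h2 : ∀ᵐ x ∂μ.restrict K, ∀ n : ℕ, ∀ {ι : Type _} {l : Filter ι} (w : ι → E) (δ : ι → ℝ)
      (_ : Tendsto δ l (𝓝[>] 0)) (_ : ∀ᶠ j in l, x ∈ closedBall (w j) ((n + 1 : ℝ) * δ j)),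
      Tendsto (fun j => μ (K ∩ closedBall (w j) (δ j)) / μ (closedBall (w j) (δ j))) l (𝓝 1) :=
    ae_all_iff.2 fun n => IsUnifLocDoublingMeasure.ae_tendsto_measure_inter_div μ K (n + 1)
  have h1' : ∀ᵐ x ∂μ.restrict K, x ∈ K → DifferentiableWithinAt ℝ b K x :=
    ae_mono Measure.restrict_le_self h1
  have h12 := h1'.and h2
  -- K is not known to be measurable; the identity `(μ.restrict K) K = μ K` holds for every set and
  -- produces a good point inside K.
  have hne : (μ.restrict K) K ≠ 0 := by rwa [Measure.restrict_apply_self]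
  obtain ⟨z, hz, hz1, hz2⟩ : ∃ z ∈ K, (z ∈ K → DifferentiableWithinAt ℝ b K z) ∧
      ∀ n : ℕ, ∀ {ι : Type _} {l : Filter ι} (w : ι → E) (δ : ι → ℝ)
      (_ : Tendsto δ l (𝓝[>] 0)) (_ : ∀ᶠ j in l, z ∈ closedBall (w j) ((n + 1 : ℝ) * δ j)),
      Tendsto (fun j => μ (K ∩ closedBall (w j) (δ j)) / μ (closedBall (w j) (δ j))) l (𝓝 1) := by
    by_contra! hcon
    apply hne
    refine measure_mono_null (fun x hx => ?_) h12
    intro hx'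
    obtain ⟨n, ι, l, w, δ, hδ, hw, hnot⟩ := hcon x hx hx'.1
    exact hnot (hx'.2 n w δ hδ hw)
  obtain ⟨T, hT⟩ := hz1 hz
  refine ⟨z, hz, T, hasSecondOrderExpansion_of_touchesAbove hg hC hK hT fun η hη => ?_⟩
  -- The balls of radius η‖h‖ are centred at z + h rather than z; this n puts z in their (n +
  -- 1)-fold dilates, as the density theorem requires.
  obtain ⟨n, hn⟩ := exists_nat_gt (1 / η)
  have hev : ∀ᶠ h in 𝓝[≠] (0 : E), ∃ ζ ∈ K, ‖ζ - (z + h)‖ ≤ η * ‖h‖ := by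
    have ht := hz2 n (l := 𝓝[≠] (0 : E)) (fun h => z + h) (fun h => η * ‖h‖) ?_ ?_
    · filter_upwards [ht.eventually_ne one_ne_zero] with h hh
      obtain ⟨ζ, hζ⟩ : (K ∩ closedBall (z + h) (η * ‖h‖)).Nonempty := by
        rw [nonempty_iff_ne_empty]
        intro he
        rw [he] at hh
        simp at hh
      exact ⟨ζ, hζ.1, by simpa [dist_eq_norm] using hζ.2⟩
    · refine tendsto_nhdsWithin_iff.2 ⟨?_, ?_⟩
      · have : Tendsto (fun h : E => η * ‖h‖) (𝓝 0) (𝓝 (η * ‖(0 : E)‖)) :=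
          (continuous_const.mul continuous_norm).tendsto 0
        rw [norm_zero, mul_zero] at this
        exact this.mono_left nhdsWithin_le_nhds
      · filter_upwards [self_mem_nhdsWithin] with h hh
        exact mul_pos hη (norm_pos_iff.2 hh)
    · refine Eventually.of_forall fun h => ?_
      rw [mem_closedBall, dist_eq_norm]
      have : z - (z + h) = -h := by abel
      rw [this, norm_neg]
      have h3 : 1 ≤ ((n : ℝ) + 1) * η := by
        rw [div_lt_iff₀ hη] at hn; nlinarith
      nlinarith [norm_nonneg h]
  rw [eventually_nhdsWithin_iff] at hev
  filter_upwards [hev] with h hh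
  by_cases h0 : h = 0
  · subst h0
    exact ⟨z, hz, by simp⟩
  · exact hh h0

end SecondOrder

/-! ### Jensen's lemma: expansions near a maximum of a semiconvex function. -/

section PerturbedMax

variable {E : Type*} [NormedAddCommGroup E] [InnerProductSpace ℝ E]

theorem le_zero_of_eventually_of_homogeneous {q : E → ℝ} (hq : ∀ (t : ℝ) v, q (t • v) = t ^ 2 * q v)
    (h : ∀ᶠ v in 𝓝 (0 : E), q v ≤ 0) (v : E) : q v ≤ 0 := by
  have ht : Tendsto (fun t : ℝ => t • v) (𝓝[>] 0) (𝓝 0) := by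
    have : Tendsto (fun t : ℝ => t • v) (𝓝 0) (𝓝 ((0 : ℝ) • v)) :=
      (continuous_id.smul continuous_const).tendsto 0
    rw [zero_smul] at this
    exact this.mono_left nhdsWithin_le_nhds
  obtain ⟨t, ht1, ht2⟩ := ((ht.eventually h).and self_mem_nhdsWithin).exists
  rw [hq] at ht1
  have ht0 : (0 : ℝ) < t := ht2
  by_contra! hv
  exact absurd ht1 (not_le.2 (by positivity))

theorem HasSecondOrderExpansion.sub_norm_sq {g : E → ℝ} {z b : E} {T : E →L[ℝ] E}
    (h : HasSecondOrderExpansion g z b T) (c : ℝ) :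
    HasSecondOrderExpansion (fun x => g x - c * ‖x‖ ^ 2) z (b - (2 * c) • z)
      (T - (2 * c) • ContinuousLinearMap.id ℝ E) := by
  intro ε hε
  filter_upwards [h ε hε] with k hk
  convert hk using 2
  have e1 : ‖z + k‖ ^ 2 = ‖z‖ ^ 2 + 2 * ⟪z, k⟫ + ‖k‖ ^ 2 := norm_add_sq_real z k
  simp only [sub_apply, smul_apply,
    ContinuousLinearMap.id_apply, inner_sub_left, real_inner_smul_left, real_inner_self_eq_norm_sq]
  rw [e1]
  ring

theorem HasSecondOrderExpansion.inner_le {g : E → ℝ} {z b : E} {T S : E →L[ℝ] E}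
    (h : HasSecondOrderExpansion g z b T) {c : ℝ}
    (hS : ∀ k, g (z + k) ≤ g z + ⟪b, k⟫ + 1 / 2 * ⟪S k, k⟫ + c * ‖k‖ ^ 2) {ε : ℝ} (hε : 0 < ε)
    (v : E) : 1 / 2 * ⟪T v, v⟫ ≤ 1 / 2 * ⟪S v, v⟫ + (c + ε) * ‖v‖ ^ 2 := by
  have := le_zero_of_eventually_of_homogeneous
    (q := fun v => 1 / 2 * ⟪T v, v⟫ - 1 / 2 * ⟪S v, v⟫ - (c + ε) * ‖v‖ ^ 2) ?_ ?_ v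
  · linarith
  · intro t v
    simp only [map_smul, real_inner_smul_left, real_inner_smul_right, norm_smul, mul_pow,
      Real.norm_eq_abs, sq_abs]
    ring
  · filter_upwards [h ε hε] with k hk
    have h1 := hS k
    rw [abs_le] at hk
    linarith [hk.1]

theorem HasSecondOrderExpansion.le_inner {g : E → ℝ} {z b : E} {T : E →L[ℝ] E}
    (h : HasSecondOrderExpansion g z b T) {c : ℝ}
    (hS : ∀ k, g z + ⟪b, k⟫ - c * ‖k‖ ^ 2 ≤ g (z + k))
    (v : E) : - (2 * c) * ‖v‖ ^ 2 ≤ ⟪T v, v⟫ := by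
  refine le_of_forall_pos_le_add fun ε hε => ?_
  set ε' := ε / (2 * (‖v‖ ^ 2 + 1)) with hε'
  have hε'0 : 0 < ε' := by positivity
  have := le_zero_of_eventually_of_homogeneous
    (q := fun v => - (1 / 2 * ⟪T v, v⟫) - (c + ε') * ‖v‖ ^ 2) ?_ ?_ v
  · have h1 : 2 * ε' * ‖v‖ ^ 2 ≤ ε := by
      have : 2 * ε' * (‖v‖ ^ 2 + 1) = ε := by rw [hε']; field_simp
      nlinarith
    linarith
  · intro t v
    simp only [map_smul, real_inner_smul_left, real_inner_smul_right, norm_smul, mul_pow,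
      Real.norm_eq_abs, sq_abs]
    ring
  · filter_upwards [h ε' hε'0] with k hk
    have h1 := hS k
    rw [abs_le] at hk
    linarith [hk.2]

theorem half_inner_add (S : E →L[ℝ] E) (hS : ∀ x y, ⟪S x, y⟫ = ⟪x, S y⟫) (z k : E) :
    1 / 2 * ⟪S (z + k), z + k⟫ = 1 / 2 * ⟪S z, z⟫ + ⟪S z, k⟫ + 1 / 2 * ⟪S k, k⟫ := by
  rw [map_add, inner_add_left, inner_add_right, inner_add_right, hS k z, real_inner_comm (S z) k]
  ring

/-- The points at which `W - ½⟪S ·, ·⟫ - σ‖·‖²` has a global maximum after subtraction of a linear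
function of slope `a`. -/
def MaximizesWithSlope (W : E → ℝ) (S : E →L[ℝ] E) (σ : ℝ) (z a : E) : Prop :=
  ∀ z', W z' - 1 / 2 * ⟪S z', z'⟫ - σ * ‖z'‖ ^ 2 - ⟪a, z'⟫ ≤
    W z - 1 / 2 * ⟪S z, z⟫ - σ * ‖z‖ ^ 2 - ⟪a, z⟫

theorem MaximizesWithSlope.le {W : E → ℝ} {S : E →L[ℝ] E} {σ : ℝ} {z a : E}
    (h : MaximizesWithSlope W S σ z a) (hS : ∀ x y, ⟪S x, y⟫ = ⟪x, S y⟫) (k : E) :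
    W (z + k) ≤ W z + ⟪a + S z + (2 * σ) • z, k⟫ + 1 / 2 * ⟪S k, k⟫ + σ * ‖k‖ ^ 2 := by
  have h1 := h (z + k)
  rw [half_inner_add S hS, norm_add_sq_real, inner_add_right a] at h1
  rw [inner_add_left, inner_add_left, real_inner_smul_left]
  linarith

theorem MaximizesWithSlope.touchesAbove {W : E → ℝ} {S : E →L[ℝ] E} {σ : ℝ} {z a : E}
    (h : MaximizesWithSlope W S σ z a) (hS : ∀ x y, ⟪S x, y⟫ = ⟪x, S y⟫) (c : ℝ) :
    TouchesAbove (fun x => W x + c * ‖x‖ ^ 2) (‖S‖ + σ + c) z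
      (a + S z + (2 * σ) • z + (2 * c) • z) := by
  intro z'
  have h1 := h.le hS (z' - z)
  have h2 : ⟪S (z' - z), z' - z⟫ ≤ ‖S‖ * ‖z' - z‖ ^ 2 := by
    refine (real_inner_le_norm _ _).trans ?_
    calc _ ≤ ‖S‖ * ‖z' - z‖ * ‖z' - z‖ := by gcongr; exact S.le_opNorm _
      _ = _ := by ring
  have h3 : ‖z'‖ ^ 2 = ‖z‖ ^ 2 + 2 * ⟪z, z' - z⟫ + ‖z' - z‖ ^ 2 := by
    rw [← norm_add_sq_real, add_sub_cancel]
  have h4 : 0 ≤ ‖S‖ * ‖z' - z‖ ^ 2 := by positivity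
  rw [add_sub_cancel] at h1
  simp only
  rw [h3, inner_add_left _ ((2 * c) • z), real_inner_smul_left]
  linarith

/-- Comparison with the origin gives σ‖z‖² ≤ -⟪a, z⟫. A slope of size σ² is thus beaten by the
penalty σ‖z‖² outside the ball of radius σ. -/
theorem MaximizesWithSlope.norm_le {W : E → ℝ} {S : E →L[ℝ] E} {σ : ℝ} (hσ : 0 < σ) {z a : E}
    (h : MaximizesWithSlope W S σ z a) (ha : ‖a‖ ≤ σ ^ 2)
    (hW : ∀ z, W z ≤ W 0 + 1 / 2 * ⟪S z, z⟫) : ‖z‖ ≤ σ := by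
  have h1 := h 0
  have h2 := hW z
  have h3 : -⟪a, z⟫ ≤ σ ^ 2 * ‖z‖ := by
    rw [← inner_neg_left]
    refine (real_inner_le_norm _ _).trans ?_
    rw [norm_neg]; gcongr
  simp only [map_zero, inner_zero_right, norm_zero] at h1
  have h4 : σ * ‖z‖ ^ 2 ≤ σ ^ 2 * ‖z‖ := by linarith
  by_contra! hlt
  have h5 : 0 < σ * ‖z‖ := by nlinarith
  nlinarith

theorem exists_maximizesWithSlope [FiniteDimensional ℝ E] {W : E → ℝ} (hWc : Continuous W)
    {S : E →L[ℝ] E} {σ : ℝ} (hσ : 0 < σ) (hW : ∀ z, W z ≤ W 0 + 1 / 2 * ⟪S z, z⟫) {a : E}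
    (ha : ‖a‖ ≤ σ ^ 2) : ∃ z, MaximizesWithSlope W S σ z a := by
  set f : E → ℝ := fun z' => W z' - 1 / 2 * ⟪S z', z'⟫ - σ * ‖z'‖ ^ 2 - ⟪a, z'⟫ with hf
  have hfc : Continuous f := by fun_prop
  obtain ⟨z, hz, hmax⟩ := (isCompact_closedBall (0 : E) σ).exists_isMaxOn
    ⟨0, mem_closedBall_self hσ.le⟩ hfc.continuousOn
  refine ⟨z, fun z' => ?_⟩
  by_cases hz' : ‖z'‖ ≤ σ
  · exact hmax (by simpa using hz')
  · push Not at hz'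
    have h0 : f 0 ≤ f z := hmax (mem_closedBall_self hσ.le)
    refine le_trans ?_ h0
    simp only [hf, map_zero, inner_zero_right, norm_zero]
    have h2 := hW z'
    have h3 : -⟪a, z'⟫ ≤ σ ^ 2 * ‖z'‖ := by
      rw [← inner_neg_left]
      refine (real_inner_le_norm _ _).trans ?_
      rw [norm_neg]; gcongr
    have : σ * (σ * ‖z'‖) ≤ σ * (‖z'‖ * ‖z'‖) := by gcongr
    nlinarith

variable [FiniteDimensional ℝ E]

-- The set K of maximizers carries a slope map that is single-valued and Lipschitz, and whose image
-- contains a ball of slopes. Lipschitz maps send null sets for top-dimensional Hausdorff measure to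
-- null sets, so K has positive measure and the expansion theorem applies on it.
open Module in
theorem exists_slope_expansion {W : E → ℝ} {c : ℝ} (hc : 0 < c)
    (hconv : ConvexOn ℝ univ fun z => W z + c * ‖z‖ ^ 2) {S : E →L[ℝ] E}
    (hS : ∀ x y, ⟪S x, y⟫ = ⟪x, S y⟫) (hW : ∀ z, W z ≤ W 0 + 1 / 2 * ⟪S z, z⟫) {σ : ℝ}
    (hσ : 0 < σ) :
    ∃ z a : E, ‖a‖ ≤ σ ^ 2 ∧ MaximizesWithSlope W S σ z a ∧
      ∃ T, HasSecondOrderExpansion W z (a + S z + (2 * σ) • z) T := by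
  let _ : MeasurableSpace E := borel E
  have _ : BorelSpace E := ⟨rfl⟩
  set g : E → ℝ := fun z => W z + c * ‖z‖ ^ 2 with hg
  have hgc : Continuous g := continuousOn_univ.1 (hconv.continuousOn isOpen_univ)
  have hWc : Continuous W := by
    have : W = fun z => g z - c * ‖z‖ ^ 2 := by funext z; simp [hg]
    rw [this]; fun_prop
  set K : Set E := {z | ∃ a, ‖a‖ ≤ σ ^ 2 ∧ MaximizesWithSlope W S σ z a} with hK
  choose! a ha using fun z (hz : z ∈ K) => hz
  set b : E → E := fun z => a z + S z + (2 * σ) • z + (2 * c) • z with hb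
  set C := ‖S‖ + σ + c with hC
  have hC0 : 0 < C := by positivity
  have htouch : ∀ z ∈ K, TouchesAbove g C z (b z) := fun z hz => (ha z hz).2.touchesAbove hS c
  have huniq : ∀ z ∈ K, ∀ a', MaximizesWithSlope W S σ z a' → a z = a' := by
    intro z hz a' ha'
    have h1 := (htouch z hz).norm_slope_sub_le (ha'.touchesAbove hS c) hconv hC0
    rw [sub_self, norm_zero, mul_zero, norm_le_zero_iff, sub_eq_zero] at h1
    simpa [hb] using h1
  have hlip : LipschitzOnWith (Real.toNNReal (2 * C + (‖S‖ + 2 * σ + 2 * c))) a K := by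
    refine LipschitzOnWith.of_dist_le_mul fun x hx y hy => ?_
    rw [dist_eq_norm, dist_eq_norm, Real.coe_toNNReal _ (by positivity)]
    have h1 := (htouch x hx).norm_slope_sub_le (htouch y hy) hconv hC0
    have h2 : a x - a y = (b x - b y) - (S (x - y) + (2 * σ) • (x - y) + (2 * c) • (x - y)) := by
      simp only [hb, map_sub]; module
    rw [h2]
    refine (norm_sub_le _ _).trans ?_
    have h3 : ‖S (x - y) + (2 * σ) • (x - y) + (2 * c) • (x - y)‖ ≤
        ‖S‖ * ‖x - y‖ + (2 * σ) * ‖x - y‖ + (2 * c) * ‖x - y‖ := by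
      refine (norm_add₃_le).trans ?_
      rw [norm_smul, norm_smul, Real.norm_eq_abs, Real.norm_eq_abs,
        abs_of_pos (by positivity : 0 < 2 * σ), abs_of_pos (by positivity : 0 < 2 * c)]
      gcongr
      exact S.le_opNorm _
    linarith
  have hμ : (Measure.hausdorffMeasure (finrank ℝ E : ℝ) : Measure E) K ≠ 0 := by
    intro h0
    have h1 := hlip.hausdorffMeasure_image_le (d := (finrank ℝ E : ℝ)) (Nat.cast_nonneg _)
    rw [h0, mul_zero, nonpos_iff_eq_zero] at h1
    have h2 : ball (0 : E) (σ ^ 2) ⊆ a '' K := by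
      intro a' ha'
      rw [mem_ball_zero_iff] at ha'
      obtain ⟨z, hz⟩ := exists_maximizesWithSlope hWc hσ hW ha'.le
      have hzK : z ∈ K := ⟨a', ha'.le, hz⟩
      exact ⟨z, hzK, huniq z hzK a' hz⟩
    exact (measure_ball_pos _ (0 : E) (by positivity : 0 < σ ^ 2)).ne' (measure_mono_null h2 h1)
  obtain ⟨z, hzK, T, hT⟩ := exists_hasSecondOrderExpansion hconv hC0 htouch _ hμ
  refine ⟨z, a z, (ha z hzK).1, (ha z hzK).2, T - (2 * c) • ContinuousLinearMap.id ℝ E, ?_⟩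
  have h1 := hT.sub_norm_sq c
  have h2 : (fun x => g x - c * ‖x‖ ^ 2) = W := by funext x; simp [hg]
  have h3 : b z - (2 * c) • z = a z + S z + (2 * σ) • z := by simp only [hb]; abel
  rwa [h2, h3] at h1

/-- At points arbitrarily close to a global maximum of `W - ½⟪S ·, ·⟫`, a semiconvex function `W`
has second-order expansions whose Hessian is almost bounded by `S`. -/
theorem exists_hasSecondOrderExpansion_near_max {W : E → ℝ} {c : ℝ} (hc : 0 < c)
    (hconv : ConvexOn ℝ univ fun z => W z + c * ‖z‖ ^ 2) {S : E →L[ℝ] E}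
    (hS : ∀ x y, ⟪S x, y⟫ = ⟪x, S y⟫) (hW : ∀ z, W z ≤ W 0 + 1 / 2 * ⟪S z, z⟫) {δ : ℝ}
    (hδ : 0 < δ) :
    ∃ (z b : E) (T : E →L[ℝ] E), ‖z‖ ≤ δ ∧ ‖b‖ ≤ δ ∧ W 0 + 1 / 2 * ⟪S z, z⟫ ≤ W z + δ ∧
      HasSecondOrderExpansion W z b T ∧
      (∀ v, 1 / 2 * ⟪T v, v⟫ ≤ 1 / 2 * ⟪S v, v⟫ + δ * ‖v‖ ^ 2) ∧
      ∀ v, - (2 * c) * ‖v‖ ^ 2 ≤ ⟪T v, v⟫ := by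
  -- The gradient a + Sz + 2σz has norm at most (3 + ‖S‖)σ, and the Hessian error is 2σ; both are
  -- then at most δ.
  set σ := min 1 (δ / (3 + ‖S‖)) with hσdef
  have hσ : 0 < σ := by positivity
  have hσ1 : σ ≤ 1 := min_le_left _ _
  have hσδ : σ * (3 + ‖S‖) ≤ δ := by
    rw [← le_div_iff₀ (by positivity)]; exact min_le_right _ _
  have hS0 := norm_nonneg S
  have hσS : 0 ≤ σ * ‖S‖ := by positivity
  obtain ⟨z, a, ha, hmax, T, hT⟩ := exists_slope_expansion hc hconv hS hW hσ
  have hz := hmax.norm_le hσ ha hW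
  have hσ2 : σ ^ 2 ≤ σ := by nlinarith
  refine ⟨z, _, T, by linarith, ?_, ?_, hT, fun v => ?_, ?_⟩
  · refine norm_add₃_le.trans ?_
    rw [norm_smul, Real.norm_eq_abs, abs_of_pos (by positivity : 0 < 2 * σ)]
    have h1 : ‖S z‖ ≤ ‖S‖ * σ := (S.le_opNorm z).trans (by gcongr)
    have h2 : 2 * σ * ‖z‖ ≤ 2 * σ := by nlinarith
    nlinarith
  · have h1 := hmax 0
    simp only [map_zero, inner_zero_right, norm_zero] at h1
    have h3 : -⟪a, z⟫ ≤ σ := by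
      rw [← inner_neg_left]
      refine (real_inner_le_norm _ _).trans ?_
      rw [norm_neg]
      have := norm_nonneg z
      have := norm_nonneg a
      nlinarith
    have h4 : 0 ≤ σ * ‖z‖ ^ 2 := by positivity
    linarith
  · have h1 := hT.inner_le (hmax.le hS) hσ v
    have h2 : (σ + σ) * ‖v‖ ^ 2 ≤ δ * ‖v‖ ^ 2 := by gcongr; linarith
    linarith
  · refine hT.le_inner fun k => ?_
    have h1 := (hmax.touchesAbove hS c).subgradient hconv (by positivity) (z + k)
    rw [add_sub_cancel_left, norm_add_sq_real, inner_add_left _ ((2 * c) • z),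
      real_inner_smul_left] at h1
    linarith

end PerturbedMax

/-! ### Sup-convolution. -/

section SupConvolution

variable {H : Type*} [NormedAddCommGroup H]

/-- The sup-convolution `x ↦ sup_{ξ ∈ N} (u ξ - c‖x - ξ‖²)`. -/
noncomputable def supConvolution (N : Set H) (c : ℝ) (u : H → ℝ) (x : H) : ℝ :=
  sSup ((fun ξ => u ξ - c * ‖x - ξ‖ ^ 2) '' N)

theorem exists_eq_supConvolution {N : Set H} (hN : IsCompact N) (hne : N.Nonempty) {u : H → ℝ}
    (hu : ContinuousOn u N) (c : ℝ) (x : H) :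
    ∃ ξ ∈ N, supConvolution N c u x = u ξ - c * ‖x - ξ‖ ^ 2 := by
  have hc : ContinuousOn (fun ξ => u ξ - c * ‖x - ξ‖ ^ 2) N := by fun_prop
  obtain ⟨ξ, hξ, h⟩ := hN.exists_sSup_image_eq hne hc
  exact ⟨ξ, hξ, h⟩

theorem le_supConvolution {N : Set H} (hN : IsCompact N) {u : H → ℝ}
    (hu : ContinuousOn u N) (c : ℝ) (x : H) {ξ : H} (hξ : ξ ∈ N) :
    u ξ - c * ‖x - ξ‖ ^ 2 ≤ supConvolution N c u x := by
  have hc : ContinuousOn (fun ξ => u ξ - c * ‖x - ξ‖ ^ 2) N := by fun_prop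
  exact le_csSup (hN.bddAbove_image hc) (mem_image_of_mem _ hξ)

/-- Adding c‖x‖² cancels the quadratic part of each competitor, leaving a supremum of affine
functions of x. -/
theorem convexOn_supConvolution [InnerProductSpace ℝ H] {N : Set H} (hN : IsCompact N) (hne : N.Nonempty) {u : H → ℝ}
    (hu : ContinuousOn u N) (c : ℝ) :
    ConvexOn ℝ univ fun x => supConvolution N c u x + c * ‖x‖ ^ 2 := by
  refine ⟨convex_univ, fun x _ y _ a b ha hb hab => ?_⟩
  obtain ⟨ξ, hξ, h⟩ := exists_eq_supConvolution hN hne hu c (a • x + b • y)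
  have hx := le_supConvolution hN hu c x hξ
  have hy := le_supConvolution hN hu c y hξ
  simp only [smul_eq_mul]
  rw [h]
  rw [norm_sub_sq_real] at hx hy ⊢
  rw [inner_add_left, real_inner_smul_left, real_inner_smul_left]
  have e1 := mul_le_mul_of_nonneg_left hx ha
  have e2 := mul_le_mul_of_nonneg_left hy hb
  have hb' : b = 1 - a := by linarith
  subst hb'
  linarith

end SupConvolution

/-! ### The approximate theorem on sums. -/

section TheoremOnSums

variable {H : Type*} [NormedAddCommGroup H] [InnerProductSpace ℝ H] [FiniteDimensional ℝ H]

set_option maxHeartbeats 800000 in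
/-- An approximate form of the theorem on sums, centered at the origin. -/
theorem exists_jets_of_sum_le_at_zero {N₁ N₂ : Set H} (hN₁ : IsCompact N₁) (hN₂ : IsCompact N₂)
    (h₁ : (0 : H) ∈ N₁) (h₂ : (0 : H) ∈ N₂) {u v : H → ℝ} (hu : ContinuousOn u N₁)
    (hv : ContinuousOn v N₂) {c κ : ℝ} (hc : 0 < c) (hκ : 0 < κ)
    {S : WithLp 2 (H × H) →L[ℝ] WithLp 2 (H × H)} (hS : ∀ x y, ⟪S x, y⟫ = ⟪x, S y⟫)
    (hle : ∀ ξ ∈ N₁, ∀ η ∈ N₂, ∀ z : WithLp 2 (H × H),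
      u ξ + v η - c * (‖z.fst - ξ‖ ^ 2 + ‖z.snd - η‖ ^ 2) ≤
        u 0 + v 0 + 1 / 2 * ⟪S z, z⟫ - κ * (‖z.fst - ξ‖ ^ 2 + ‖z.snd - η‖ ^ 2))
    {δ : ℝ} (hδ : 0 < δ) :
    ∃ ξ ∈ N₁, ∃ η ∈ N₂, ∃ (a b : H) (X Y : H →L[ℝ] H), ‖ξ‖ ≤ δ ∧ ‖η‖ ≤ δ ∧ ‖a‖ ≤ δ ∧ ‖b‖ ≤ δ ∧
      (∀ ε > 0, ∀ᶠ k in 𝓝 (0 : H), ξ + k ∈ N₁ →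
        u (ξ + k) ≤ u ξ + ⟪a, k⟫ + 1 / 2 * ⟪X k, k⟫ + ε * ‖k‖ ^ 2) ∧
      (∀ ε > 0, ∀ᶠ k in 𝓝 (0 : H), η + k ∈ N₂ →
        v (η + k) ≤ v η + ⟪b, k⟫ + 1 / 2 * ⟪Y k, k⟫ + ε * ‖k‖ ^ 2) ∧
      (∀ k l, 1 / 2 * ⟪X k, k⟫ + 1 / 2 * ⟪Y l, l⟫ ≤
        1 / 2 * ⟪S (WithLp.toLp 2 (k, l)), WithLp.toLp 2 (k, l)⟫ + δ * (‖k‖ ^ 2 + ‖l‖ ^ 2)) ∧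
      (∀ k, - (2 * c) * ‖k‖ ^ 2 ≤ ⟪X k, k⟫) ∧ ∀ k, - (2 * c) * ‖k‖ ^ 2 ≤ ⟪Y k, k⟫ := by
  set U := supConvolution N₁ c u with hU
  set V := supConvolution N₂ c v with hV
  set W : WithLp 2 (H × H) → ℝ := fun z => U z.fst + V z.snd with hWdef
  have hconvU := convexOn_supConvolution hN₁ ⟨0, h₁⟩ hu c
  have hconvV := convexOn_supConvolution hN₂ ⟨0, h₂⟩ hv c
  have hconv : ConvexOn ℝ univ fun z => W z + c * ‖z‖ ^ 2 := by
    refine ⟨convex_univ, fun x _ y _ a b ha hb hab => ?_⟩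
    have e1 := hconvU.2 (mem_univ x.fst) (mem_univ y.fst) ha hb hab
    have e2 := hconvV.2 (mem_univ x.snd) (mem_univ y.snd) ha hb hab
    simp only [hWdef, WithLp.prod_norm_sq_eq_of_L2, WithLp.add_fst, WithLp.add_snd,
      WithLp.smul_fst, WithLp.smul_snd, smul_eq_mul] at e1 e2 ⊢
    linarith
  have hU0 : u 0 ≤ U 0 := by simpa using le_supConvolution hN₁ hu c 0 h₁
  have hV0 : v 0 ≤ V 0 := by simpa using le_supConvolution hN₂ hv c 0 h₂
  have hW0 : W 0 = U 0 + V 0 := rfl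
  have hWle : ∀ z, W z ≤ W 0 + 1 / 2 * ⟪S z, z⟫ := by
    intro z
    obtain ⟨ξ, hξ, e1⟩ := exists_eq_supConvolution hN₁ ⟨0, h₁⟩ hu c z.fst
    obtain ⟨η, hη, e2⟩ := exists_eq_supConvolution hN₂ ⟨0, h₂⟩ hv c z.snd
    have e3 := hle ξ hξ η hη z
    have e4 : 0 ≤ κ * (‖z.fst - ξ‖ ^ 2 + ‖z.snd - η‖ ^ 2) := by positivity
    have e5 : W z = U z.fst + V z.snd := rfl
    rw [e5, hW0, hU, hV, e1, e2]
    linarith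
  -- At an almost maximal z, the margin κ in `hle` forces κ(‖z.fst - ξ‖² + ‖z.snd - η‖²) ≤ δ'; hence
  -- the bound κ(δ/2)².
  set δ' := min (δ / 2) (κ * δ ^ 2 / 4) with hδ'
  have hδ'0 : 0 < δ' := by positivity
  have hδ'1 : δ' ≤ δ / 2 := min_le_left _ _
  have hδ'2 : δ' ≤ κ * δ ^ 2 / 4 := min_le_right _ _
  obtain ⟨z, b, T, hz, hb, hWz, hT, hTS, hTc⟩ :=
    exists_hasSecondOrderExpansion_near_max hc hconv hS hWle hδ'0
  obtain ⟨ξ, hξ, e1⟩ := exists_eq_supConvolution hN₁ ⟨0, h₁⟩ hu c z.fst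
  obtain ⟨η, hη, e2⟩ := exists_eq_supConvolution hN₂ ⟨0, h₂⟩ hv c z.snd
  have hWz' : W z = U z.fst + V z.snd := rfl
  have hclose : κ * (‖z.fst - ξ‖ ^ 2 + ‖z.snd - η‖ ^ 2) ≤ κ * (δ / 2) ^ 2 := by
    have e3 := hle ξ hξ η hη z
    rw [hWz', hW0, hU, hV, e1, e2] at hWz
    rw [hU] at hU0
    rw [hV] at hV0
    linarith
  have hclose' := le_of_mul_le_mul_left hclose hκ
  have hc1 : ‖z.fst - ξ‖ ≤ δ / 2 :=
    (pow_le_pow_iff_left₀ (norm_nonneg _) (by positivity) two_ne_zero).1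
      (by nlinarith [sq_nonneg ‖z.snd - η‖])
  have hc2 : ‖z.snd - η‖ ≤ δ / 2 :=
    (pow_le_pow_iff_left₀ (norm_nonneg _) (by positivity) two_ne_zero).1
      (by nlinarith [sq_nonneg ‖z.fst - ξ‖])
  have hfst : ∀ y : WithLp 2 (H × H), ‖y.fst‖ ≤ ‖y‖ := fun y =>
    (pow_le_pow_iff_left₀ (norm_nonneg _) (norm_nonneg _) two_ne_zero).1
      (by rw [WithLp.prod_norm_sq_eq_of_L2]; nlinarith [sq_nonneg ‖y.snd‖])
  have hsnd : ∀ y : WithLp 2 (H × H), ‖y.snd‖ ≤ ‖y‖ := fun y =>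
    (pow_le_pow_iff_left₀ (norm_nonneg _) (norm_nonneg _) two_ne_zero).1
      (by rw [WithLp.prod_norm_sq_eq_of_L2]; nlinarith [sq_nonneg ‖y.fst‖])
  set ι₁ : H →L[ℝ] WithLp 2 (H × H) :=
    ((WithLp.prodContinuousLinearEquiv 2 ℝ H H).symm : H × H →L[ℝ] WithLp 2 (H × H)).comp
      (ContinuousLinearMap.inl ℝ H H) with hι₁
  set ι₂ : H →L[ℝ] WithLp 2 (H × H) :=
    ((WithLp.prodContinuousLinearEquiv 2 ℝ H H).symm : H × H →L[ℝ] WithLp 2 (H × H)).comp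
      (ContinuousLinearMap.inr ℝ H H) with hι₂
  have i1 : ∀ k, ι₁ k = WithLp.toLp 2 (k, 0) := fun k => rfl
  have i2 : ∀ k, ι₂ k = WithLp.toLp 2 (0, k) := fun k => rfl
  have n1 : ∀ k, ‖ι₁ k‖ ^ 2 = ‖k‖ ^ 2 := fun k => by
    rw [i1, WithLp.prod_norm_sq_eq_of_L2]; simp
  have n2 : ∀ k, ‖ι₂ k‖ ^ 2 = ‖k‖ ^ 2 := fun k => by
    rw [i2, WithLp.prod_norm_sq_eq_of_L2]; simp
  set π₁ : WithLp 2 (H × H) →L[ℝ] H := (ContinuousLinearMap.fst ℝ H H).comp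
    (WithLp.prodContinuousLinearEquiv 2 ℝ H H : WithLp 2 (H × H) →L[ℝ] H × H) with hπ₁
  set π₂ : WithLp 2 (H × H) →L[ℝ] H := (ContinuousLinearMap.snd ℝ H H).comp
    (WithLp.prodContinuousLinearEquiv 2 ℝ H H : WithLp 2 (H × H) →L[ℝ] H × H) with hπ₂
  have p1 : ∀ y, π₁ y = y.fst := fun y => rfl
  have p2 : ∀ y, π₂ y = y.snd := fun y => rfl
  have in1 : ∀ y k, ⟪y, ι₁ k⟫ = ⟪y.fst, k⟫ := fun y k => by
    rw [i1, WithLp.prod_inner_apply]; simp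
  have in2 : ∀ y k, ⟪y, ι₂ k⟫ = ⟪y.snd, k⟫ := fun y k => by
    rw [i2, WithLp.prod_inner_apply]; simp
  have W1 : ∀ k, W (z + ι₁ k) = U (z.fst + k) + V z.snd := fun k => by
    simp [hWdef, i1]
  have W2 : ∀ k, W (z + ι₂ k) = U z.fst + V (z.snd + k) := fun k => by
    simp [hWdef, i2]
  have t1 : Tendsto ι₁ (𝓝 0) (𝓝 0) := by simpa using ι₁.continuous.tendsto 0
  have t2 : Tendsto ι₂ (𝓝 0) (𝓝 0) := by simpa using ι₂.continuous.tendsto 0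
  refine ⟨ξ, hξ, η, hη, b.fst, b.snd, π₁.comp (T.comp ι₁), π₂.comp (T.comp ι₂), ?_, ?_,
    (hfst b).trans (by linarith), (hsnd b).trans (by linarith), ?_, ?_, ?_, ?_, ?_⟩
  · have : ξ = z.fst - (z.fst - ξ) := by abel
    rw [this]
    refine (norm_sub_le _ _).trans ?_
    linarith [hfst z]
  · have : η = z.snd - (z.snd - η) := by abel
    rw [this]
    refine (norm_sub_le _ _).trans ?_
    linarith [hsnd z]
  · intro ε hε
    filter_upwards [t1.eventually (hT ε hε)] with k hk hkN
    rw [W1, hWz', in1, in1, n1, abs_le] at hk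
    -- Moving the base point and the optimal ξ by the same k leaves the penalty unchanged, so the
    -- jet of U at `z.fst` is also a superjet of u at ξ.
    have e3 := le_supConvolution hN₁ hu c (z.fst + k) hkN
    rw [add_sub_add_right_eq_sub] at e3
    simp only [ContinuousLinearMap.comp_apply, p1]
    rw [hU] at hk
    rw [e1] at hk
    linarith [hk.2]
  · intro ε hε
    filter_upwards [t2.eventually (hT ε hε)] with k hk hkN
    rw [W2, hWz', in2, in2, n2, abs_le] at hk
    have e3 := le_supConvolution hN₂ hv c (z.snd + k) hkN
    rw [add_sub_add_right_eq_sub] at e3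
    simp only [ContinuousLinearMap.comp_apply, p2]
    rw [hV] at hk
    rw [e2] at hk
    linarith [hk.2]
  · intro k l
    simp only [ContinuousLinearMap.comp_apply, p1, p2]
    have hsplit : ∀ y : WithLp 2 (H × H), y = ι₁ y.fst + ι₂ y.snd := fun y => by
      rw [i1, i2, ← WithLp.toLp_add]; simp; rfl
    -- W is a sum of functions of separate variables. Comparing its expansions along y, (y.fst, 0)
    -- and (0, y.snd) therefore shows that the mixed part of T contributes nothing beyond an
    -- arbitrarily small error.
    have hq := le_zero_of_eventually_of_homogeneous
      (q := fun y : WithLp 2 (H × H) => 1 / 2 * ⟪T (ι₁ y.fst), ι₁ y.fst⟫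
        + 1 / 2 * ⟪T (ι₂ y.snd), ι₂ y.snd⟫ - 1 / 2 * ⟪T y, y⟫ - δ / 2 * ‖y‖ ^ 2) ?_ ?_
        (WithLp.toLp 2 (k, l))
    · have h3 := hTS (WithLp.toLp 2 (k, l))
      have h4 : ‖WithLp.toLp 2 (k, l)‖ ^ 2 = ‖k‖ ^ 2 + ‖l‖ ^ 2 :=
        WithLp.prod_norm_sq_eq_of_L2 _
      change 1 / 2 * ⟪T (ι₁ k), ι₁ k⟫ + 1 / 2 * ⟪T (ι₂ l), ι₂ l⟫ -
        1 / 2 * ⟪T (WithLp.toLp 2 (k, l)), WithLp.toLp 2 (k, l)⟫ -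
        δ / 2 * ‖WithLp.toLp 2 (k, l)‖ ^ 2 ≤ 0 at hq
      rw [h4] at h3 hq
      rw [in1, in2] at hq
      have h5 : δ' * (‖k‖ ^ 2 + ‖l‖ ^ 2) ≤ δ / 2 * (‖k‖ ^ 2 + ‖l‖ ^ 2) := by gcongr
      linarith
    · intro t y
      simp only [WithLp.smul_fst, WithLp.smul_snd, map_smul, real_inner_smul_left,
        real_inner_smul_right, norm_smul, mul_pow, Real.norm_eq_abs, sq_abs]
      ring
    · have hε : 0 < δ / 4 := by positivity
      have s1 : Tendsto (fun y : WithLp 2 (H × H) => ι₁ y.fst) (𝓝 0) (𝓝 0) := by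
        have := (ι₁.comp π₁).continuous.tendsto 0
        rwa [map_zero] at this
      have s2 : Tendsto (fun y : WithLp 2 (H × H) => ι₂ y.snd) (𝓝 0) (𝓝 0) := by
        have := (ι₂.comp π₂).continuous.tendsto 0
        rwa [map_zero] at this
      filter_upwards [hT _ hε, s1.eventually (hT _ hε), s2.eventually (hT _ hε)] with y hy hy1 hy2
      rw [W1, n1, hWz', abs_le] at hy1
      rw [W2, n2, hWz', abs_le] at hy2
      rw [abs_le, hWz'] at hy
      have h6 : W (z + y) = U (z.fst + y.fst) + V (z.snd + y.snd) := rfl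
      have h7 : ⟪b, y⟫ = ⟪b, ι₁ y.fst⟫ + ⟪b, ι₂ y.snd⟫ := by
        rw [← inner_add_right, ← hsplit]
      have h8 := WithLp.prod_norm_sq_eq_of_L2 y
      rw [h6, h7, h8] at hy
      rw [h8]
      linarith [hy.2, hy1.1, hy2.1]
  · intro k
    have := hTc (ι₁ k)
    rwa [in1, n1] at this
  · intro k
    have := hTc (ι₂ k)
    rwa [in2, n2] at this

/-- An approximate form of the theorem on sums. -/
theorem exists_jets_of_sum_le {u v : H → ℝ} {x₀ y₀ p q : H} {ρ : ℝ} (hρ : 0 < ρ)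
    (hu : ContinuousOn u (closedBall x₀ ρ)) (hv : ContinuousOn v (closedBall y₀ ρ)) {c κ : ℝ}
    (hc : 0 < c) (hκ : 0 < κ)
    {S : WithLp 2 (H × H) →L[ℝ] WithLp 2 (H × H)} (hS : ∀ x y, ⟪S x, y⟫ = ⟪x, S y⟫)
    (hle : ∀ ξ η : H, ‖ξ‖ ≤ ρ → ‖η‖ ≤ ρ → ∀ z : WithLp 2 (H × H),
      u (x₀ + ξ) + v (y₀ + η) - ⟪p, ξ⟫ - ⟪q, η⟫ - c * (‖z.fst - ξ‖ ^ 2 + ‖z.snd - η‖ ^ 2) ≤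
        u x₀ + v y₀ + 1 / 2 * ⟪S z, z⟫ - κ * (‖z.fst - ξ‖ ^ 2 + ‖z.snd - η‖ ^ 2))
    {δ : ℝ} (hδ : 0 < δ) :
    ∃ (ξ η a b : H) (X Y : H →L[ℝ] H), ‖ξ - x₀‖ ≤ δ ∧ ‖η - y₀‖ ≤ δ ∧ ‖a - p‖ ≤ δ ∧ ‖b - q‖ ≤ δ ∧
      (∀ ε > 0, ∀ᶠ k in 𝓝 (0 : H),
        u (ξ + k) ≤ u ξ + ⟪a, k⟫ + 1 / 2 * ⟪X k, k⟫ + ε * ‖k‖ ^ 2) ∧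
      (∀ ε > 0, ∀ᶠ k in 𝓝 (0 : H),
        v (η + k) ≤ v η + ⟪b, k⟫ + 1 / 2 * ⟪Y k, k⟫ + ε * ‖k‖ ^ 2) ∧
      (∀ k l, 1 / 2 * ⟪X k, k⟫ + 1 / 2 * ⟪Y l, l⟫ ≤
        1 / 2 * ⟪S (WithLp.toLp 2 (k, l)), WithLp.toLp 2 (k, l)⟫ + δ * (‖k‖ ^ 2 + ‖l‖ ^ 2)) ∧
      (∀ k, - (2 * c) * ‖k‖ ^ 2 ≤ ⟪X k, k⟫) ∧ ∀ k, - (2 * c) * ‖k‖ ^ 2 ≤ ⟪Y k, k⟫ := by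
  -- The bound ρ/2 keeps the contact points inside the balls, so membership of ξ + k and η + k holds
  -- for all small k.
  set δ' := min δ (ρ / 2) with hδ'
  have hδ'0 : 0 < δ' := by positivity
  have hδ'1 : δ' ≤ δ := min_le_left _ _
  have hδ'2 : δ' ≤ ρ / 2 := min_le_right _ _
  have hcont : ∀ (w : H → ℝ) (y s : H), ContinuousOn w (closedBall y ρ) →
      ContinuousOn (fun k => w (y + k) - ⟪s, k⟫) (closedBall 0 ρ) := fun w y s hw => by
    refine ContinuousOn.sub (hw.comp (by fun_prop) fun k hk => ?_) (by fun_prop)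
    simpa [dist_eq_norm] using hk
  have h0 : (0 : H) ∈ closedBall (0 : H) ρ := mem_closedBall_self hρ.le
  obtain ⟨ξ, hξ, η, hη, a, b, X, Y, h1, h2, h3, h4, h5, h6, h7, h8, h9⟩ :=
    exists_jets_of_sum_le_at_zero (isCompact_closedBall (0 : H) ρ) (isCompact_closedBall (0 : H) ρ)
      h0 h0 (hcont u x₀ p hu) (hcont v y₀ q hv) hc hκ hS (fun ξ hξ η hη z => by
        have := hle ξ η (by simpa using hξ) (by simpa using hη) z
        simp only [add_zero, inner_zero_right, sub_zero]
        linarith) hδ'0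
  have hmem : ∀ y : H, ‖y‖ ≤ δ' → ∀ᶠ k in 𝓝 (0 : H), y + k ∈ closedBall (0 : H) ρ := fun y hy => by
    filter_upwards [Metric.ball_mem_nhds (0 : H) (by positivity : 0 < ρ / 2)] with k hk
    rw [mem_ball_zero_iff] at hk
    rw [mem_closedBall_zero_iff]
    exact (norm_add_le _ _).trans (by linarith)
  refine ⟨x₀ + ξ, y₀ + η, p + a, q + b, X, Y, by simpa using h1.trans hδ'1,
    by simpa using h2.trans hδ'1, by simpa using h3.trans hδ'1, by simpa using h4.trans hδ'1,
    fun ε hε => ?_, fun ε hε => ?_, fun k l => (h7 k l).trans ?_, h8, h9⟩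
  · filter_upwards [h5 ε hε, hmem ξ h1] with k hk hk'
    have := hk hk'
    rw [← add_assoc, inner_add_right] at this
    rw [inner_add_left]
    linarith
  · filter_upwards [h6 ε hε, hmem η h2] with k hk hk'
    have := hk hk'
    rw [← add_assoc, inner_add_right] at this
    rw [inner_add_left]
    linarith
  · gcongr

end TheoremOnSums

/-! ### Matrices, quadratic test functions and ellipticity. -/

namespace FullyNonlinear

variable {n : ℕ}

/-- The matrix of a linear map on `ℝⁿ`. -/
noncomputable def toMat (X : Eucl n →L[ℝ] Eucl n) : Matrix (Fin n) (Fin n) ℝ :=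
  (Matrix.toEuclideanCLM (𝕜 := ℝ) (n := Fin n)).symm X

theorem toEuclideanCLM_toMat (X : Eucl n →L[ℝ] Eucl n) :
    Matrix.toEuclideanCLM (𝕜 := ℝ) (n := Fin n) (toMat X) = X :=
  (Matrix.toEuclideanCLM (𝕜 := ℝ) (n := Fin n)).apply_symm_apply X

theorem toMat_apply (X : Eucl n →L[ℝ] Eucl n) (i j : Fin n) :
    toMat X i j = ⟪EuclideanSpace.single i 1, X (EuclideanSpace.single j 1)⟫ := by
  conv_rhs => rw [← toEuclideanCLM_toMat X]
  rw [Matrix.inner_toEuclideanCLM]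
  simp

theorem opNorm_toMat (X : Eucl n →L[ℝ] Eucl n) : opNorm (toMat X) = ‖X‖ := by
  rw [opNorm, toEuclideanCLM_toMat]

theorem isSymm_toMat {X : Eucl n →L[ℝ] Eucl n} (hX : ∀ x y, ⟪X x, y⟫ = ⟪x, X y⟫) :
    (toMat X).IsSymm := by
  ext i j
  rw [Matrix.transpose_apply, toMat_apply, toMat_apply, ← hX, real_inner_comm]

theorem posSemidef_toMat {X : Eucl n →L[ℝ] Eucl n} (hX : ∀ x y, ⟪X x, y⟫ = ⟪x, X y⟫)
    (h : ∀ x, 0 ≤ ⟪X x, x⟫) : (toMat X).PosSemidef := by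
  refine Matrix.PosSemidef.of_dotProduct_mulVec_nonneg ?_ fun x => ?_
  · rw [Matrix.IsHermitian, Matrix.conjTranspose_eq_transpose_of_trivial]
    exact isSymm_toMat hX
  · have h1 := h (WithLp.toLp 2 x)
    rw [real_inner_comm, ← toEuclideanCLM_toMat X, Matrix.inner_toEuclideanCLM] at h1
    simpa using h1

theorem toMat_sub (X Y : Eucl n →L[ℝ] Eucl n) : toMat (X - Y) = toMat X - toMat Y := by
  simp [toMat]

theorem trace_toMat_smul_id (κ : ℝ) :
    (toMat (κ • ContinuousLinearMap.id ℝ (Eucl n))).trace = κ * n := by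
  have : toMat (κ • ContinuousLinearMap.id ℝ (Eucl n)) = κ • (1 : Matrix (Fin n) (Fin n) ℝ) := by
    have h1 : ContinuousLinearMap.id ℝ (Eucl n) = 1 := rfl
    rw [toMat, map_smul, h1, map_one]
  rw [this, Matrix.trace_smul, Matrix.trace_one]
  simp

-- Factoring X = BᵀB turns the trace into the sum of the squared entries of B; Cauchy–Schwarz on
-- each row finishes.
open scoped MatrixOrder in
theorem inner_le_trace_toMat {X : Eucl n →L[ℝ] Eucl n} (hX : ∀ x y, ⟪X x, y⟫ = ⟪x, X y⟫)
    (h : ∀ x, 0 ≤ ⟪X x, x⟫) (e : Eucl n) : ⟪X e, e⟫ ≤ (toMat X).trace * ‖e‖ ^ 2 := by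
  obtain ⟨B, hB⟩ := CStarAlgebra.nonneg_iff_eq_star_mul_self.1
    (Matrix.nonneg_iff_posSemidef.2 (posSemidef_toMat hX h))
  have h1 : ⟪X e, e⟫ = ∑ i, (∑ j, B i j * e j) ^ 2 := by
    rw [real_inner_comm, ← toEuclideanCLM_toMat X, Matrix.inner_toEuclideanCLM, hB,
      ← Matrix.mulVec_mulVec, Matrix.dotProduct_mulVec, Matrix.star_eq_conjTranspose,
      Matrix.conjTranspose_eq_transpose_of_trivial, Matrix.vecMul_transpose]
    simp only [dotProduct, Matrix.mulVec, sq]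
  have h2 : (toMat X).trace = ∑ i, ∑ j, B i j ^ 2 := by
    rw [hB, Matrix.trace, Finset.sum_comm]
    refine Finset.sum_congr rfl fun j _ => ?_
    rw [Matrix.diag_apply, Matrix.mul_apply]
    refine Finset.sum_congr rfl fun i _ => ?_
    simp [sq]
  rw [h1, h2, Finset.sum_mul, EuclideanSpace.real_norm_sq_eq]
  exact Finset.sum_le_sum fun i _ => Finset.sum_mul_sq_le_sq_mul_sq _ _ _

/-- Polarization: the form is evaluated at x ± y, with y the vector of length ‖x‖ in the direction
of Xx. -/
theorem norm_le_of_abs_inner_le {H : Type*} [NormedAddCommGroup H] [InnerProductSpace ℝ H]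
    {X : H →L[ℝ] H} (hX : ∀ x y, ⟪X x, y⟫ = ⟪x, X y⟫)
    {c : ℝ} (hc : 0 ≤ c) (h : ∀ x, |⟪X x, x⟫| ≤ c * ‖x‖ ^ 2) : ‖X‖ ≤ c := by
  refine X.opNorm_le_bound hc fun x => ?_
  by_cases h0 : X x = 0
  · rw [h0, norm_zero]; positivity
  have hXx : 0 < ‖X x‖ := norm_pos_iff.2 h0
  have key : ∀ y, 4 * ⟪X x, y⟫ ≤ 2 * c * (‖x‖ ^ 2 + ‖y‖ ^ 2) := by
    intro y
    have e1 := (abs_le.1 (h (x + y))).2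
    have e2 := (abs_le.1 (h (x - y))).1
    have e3 : ⟪X y, x⟫ = ⟪X x, y⟫ := by rw [hX, real_inner_comm]
    simp only [map_add, map_sub, inner_add_left, inner_add_right, inner_sub_left,
      inner_sub_right] at e1 e2
    rw [norm_add_sq_real] at e1
    rw [norm_sub_sq_real] at e2
    linarith
  have h1 := key ((‖x‖ / ‖X x‖) • X x)
  rw [real_inner_smul_right, real_inner_self_eq_norm_sq, norm_smul, Real.norm_eq_abs,
    abs_of_nonneg (by positivity)] at h1
  have h2 : ‖x‖ / ‖X x‖ * ‖X x‖ = ‖x‖ := by field_simp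
  rw [h2] at h1
  have h3 : ‖x‖ / ‖X x‖ * ‖X x‖ ^ 2 = ‖x‖ * ‖X x‖ := by field_simp
  rw [h3] at h1
  by_cases hx : x = 0
  · subst hx; simp at h0
  have hx' : 0 < ‖x‖ := norm_pos_iff.2 hx
  refine le_of_mul_le_mul_left ?_ hx'
  nlinarith

/-- The quadratic polynomial with gradient `a` and Hessian `X` at `ξ`, vanishing at `ξ`. -/
noncomputable def quadPoly (ξ a : Eucl n) (X : Eucl n →L[ℝ] Eucl n) (x : Eucl n) : ℝ :=
  ⟪a, x - ξ⟫ + 1 / 2 * ⟪X (x - ξ), x - ξ⟫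

theorem contDiff_quadPoly (ξ a : Eucl n) (X : Eucl n →L[ℝ] Eucl n) :
    ContDiff ℝ 2 (quadPoly ξ a X) := by
  have h1 : ContDiff ℝ 2 fun x : Eucl n => x - ξ := contDiff_id.sub contDiff_const
  exact (contDiff_const.inner ℝ h1).add (contDiff_const.mul ((X.contDiff.comp h1).inner ℝ h1))

theorem fderiv_quadPoly (ξ a : Eucl n) {X : Eucl n →L[ℝ] Eucl n}
    (hX : ∀ x y, ⟪X x, y⟫ = ⟪x, X y⟫) :
    fderiv ℝ (quadPoly ξ a X) = fun x => innerSL ℝ (a + X (x - ξ)) := by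
  funext x
  have h1 : HasFDerivAt (fun x => x - ξ) (ContinuousLinearMap.id ℝ (Eucl n)) x :=
    (hasFDerivAt_id x).sub_const ξ
  have h2 : HasFDerivAt (fun x => X (x - ξ)) (X.comp (ContinuousLinearMap.id ℝ (Eucl n))) x :=
    X.hasFDerivAt.comp x h1
  have h3 := ((hasFDerivAt_const a x).inner ℝ h1).add ((h2.inner ℝ h1).const_mul (1 / 2))
  refine HasFDerivAt.fderiv (h3.congr_fderiv ?_)
  ext k
  have h4 : ⟪X k, x - ξ⟫ = ⟪X (x - ξ), k⟫ := by rw [hX, real_inner_comm]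
  simp only [add_apply, smul_apply, ContinuousLinearMap.comp_apply, ContinuousLinearMap.prod_apply,
    fderivInnerCLM_apply, zero_apply, ContinuousLinearMap.id_apply, inner_zero_left, add_zero,
    smul_eq_mul, innerSL_apply_apply, inner_add_left, h4]
  ring

theorem gradient_quadPoly (ξ a : Eucl n) {X : Eucl n →L[ℝ] Eucl n}
    (hX : ∀ x y, ⟪X x, y⟫ = ⟪x, X y⟫) : gradient (quadPoly ξ a X) ξ = a := by
  rw [gradient, fderiv_quadPoly ξ a hX]
  simp only [sub_self, map_zero, add_zero]
  rw [LinearIsometryEquiv.symm_apply_eq]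
  ext k
  simp

theorem hessian_quadPoly (ξ a : Eucl n) {X : Eucl n →L[ℝ] Eucl n}
    (hX : ∀ x y, ⟪X x, y⟫ = ⟪x, X y⟫) : hessian (quadPoly ξ a X) ξ = toMat X := by
  ext i j
  rw [hessian, fderiv_quadPoly ξ a hX, Matrix.of_apply, toMat_apply]
  have h1 : HasFDerivAt (fun x => a + X (x - ξ)) X ξ := by
    have := (X.hasFDerivAt.comp ξ ((hasFDerivAt_id ξ).sub_const ξ)).const_add a
    exact this
  have h2 := ((innerSL ℝ (E := Eucl n)).hasFDerivAt.comp ξ h1).fderiv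
  have h3 : ((innerSL ℝ (E := Eucl n)) ∘ fun x => a + X (x - ξ)) =
      fun x => innerSL ℝ (a + X (x - ξ)) := rfl
  rw [h3] at h2
  rw [h2, ContinuousLinearMap.comp_apply, innerSL_apply_apply, hX]

theorem IsViscositySubsolution.apply_jet {Ω : Set (Eucl n)} {F : Nonlinearity n} {u : Eucl n → ℝ}
    (h : IsViscositySubsolution Ω F u) {ξ a : Eucl n} (hξ : ξ ∈ Ω) {X : Eucl n →L[ℝ] Eucl n}
    (hX : ∀ x y, ⟪X x, y⟫ = ⟪x, X y⟫)
    (hjet : ∀ᶠ k in 𝓝 (0 : Eucl n), u (ξ + k) ≤ u ξ + ⟪a, k⟫ + 1 / 2 * ⟪X k, k⟫) :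
    F ξ (u ξ) a (toMat X) ≤ 0 := by
  have h1 := h.2 (quadPoly ξ a X) (contDiff_quadPoly ξ a X).contDiffOn ξ hξ ?_
  · rwa [gradient_quadPoly ξ a hX, hessian_quadPoly ξ a hX] at h1
  · refine Filter.Eventually.filter_mono nhdsWithin_le_nhds ?_
    have ht : Tendsto (fun x => x - ξ) (𝓝 ξ) (𝓝 0) := by
      have := (continuous_id.sub continuous_const).tendsto (f := fun x : Eucl n => x - ξ) ξ
      rwa [sub_self] at this
    filter_upwards [ht.eventually hjet] with x hx
    rw [add_sub_cancel] at hx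
    simp only [quadPoly, sub_self, map_zero, inner_zero_right]
    linarith

theorem IsViscositySupersolution.apply_jet {Ω : Set (Eucl n)} {F : Nonlinearity n}
    {u : Eucl n → ℝ} (h : IsViscositySupersolution Ω F u) {ξ a : Eucl n} (hξ : ξ ∈ Ω)
    {X : Eucl n →L[ℝ] Eucl n} (hX : ∀ x y, ⟪X x, y⟫ = ⟪x, X y⟫)
    (hjet : ∀ᶠ k in 𝓝 (0 : Eucl n), u ξ + ⟪a, k⟫ + 1 / 2 * ⟪X k, k⟫ ≤ u (ξ + k)) :
    0 ≤ F ξ (u ξ) a (toMat X) := by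
  have h1 := h.2 (quadPoly ξ a X) (contDiff_quadPoly ξ a X).contDiffOn ξ hξ ?_
  · rwa [gradient_quadPoly ξ a hX, hessian_quadPoly ξ a hX] at h1
  · refine Filter.Eventually.filter_mono nhdsWithin_le_nhds ?_
    have ht : Tendsto (fun x => x - ξ) (𝓝 ξ) (𝓝 0) := by
      have := (continuous_id.sub continuous_const).tendsto (f := fun x : Eucl n => x - ξ) ξ
      rwa [sub_self] at this
    filter_upwards [ht.eventually hjet] with x hx
    rw [add_sub_cancel] at hx
    simp only [quadPoly, sub_self, map_zero, inner_zero_right]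
    linarith

/-- Both X and Y are compared with Z = Y + κI. The step from X to Z gains λ·Tr(Z - X), and this
trace is at least the value of Z - X at e; the step from Y to Z costs at most Λκn. -/
theorem UniformlyElliptic.le_sub {Ω : Set (Eucl n)} {F : Nonlinearity n} {lam Lam : ℝ}
    (hF : UniformlyElliptic Ω F lam Lam) (hlam : 0 ≤ lam) {η : Eucl n} (hη : η ∈ Ω) (z : ℝ)
    (q : Eucl n) {X Y : Eucl n →L[ℝ] Eucl n} (hX : ∀ x y, ⟪X x, y⟫ = ⟪x, X y⟫)
    (hY : ∀ x y, ⟪Y x, y⟫ = ⟪x, Y y⟫) {κ s : ℝ} (hκ : 0 ≤ κ)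
    (hle : ∀ v, ⟪X v, v⟫ ≤ ⟪Y v, v⟫ + κ * ‖v‖ ^ 2) {e : Eucl n} (he : ‖e‖ = 1)
    (hes : ⟪X e, e⟫ + s ≤ ⟪Y e, e⟫ + κ) :
    lam * s - Lam * (κ * n) ≤ F η z q (toMat X) - F η z q (toMat Y) := by
  set I := κ • ContinuousLinearMap.id ℝ (Eucl n) with hI
  have hIv : ∀ v, I v = κ • v := fun v => rfl
  have hIs : ∀ x y, ⟪I x, y⟫ = ⟪x, I y⟫ := fun x y => by
    rw [hIv, hIv, real_inner_smul_left, real_inner_smul_right]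
  have hIn : ∀ v, ⟪I v, v⟫ = κ * ‖v‖ ^ 2 := fun v => by
    rw [hIv, real_inner_smul_left, real_inner_self_eq_norm_sq]
  set Z := Y + I with hZ
  have hZs : ∀ x y, ⟪Z x, y⟫ = ⟪x, Z y⟫ := fun x y => by
    simp only [hZ, add_apply, inner_add_left, inner_add_right, hY, hIs]
  have hTs : ∀ x y, ⟪(Z - X) x, y⟫ = ⟪x, (Z - X) y⟫ := fun x y => by
    simp only [sub_apply, inner_sub_left, inner_sub_right, hX, hZs]
  have hTv : ∀ v, ⟪(Z - X) v, v⟫ = ⟪Y v, v⟫ + κ * ‖v‖ ^ 2 - ⟪X v, v⟫ := fun v => by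
    simp only [hZ, sub_apply, add_apply, inner_sub_left, inner_add_left, hIn]
  have hTn : ∀ v, 0 ≤ ⟪(Z - X) v, v⟫ := fun v => by
    rw [hTv]; linarith [hle v]
  have h1 := (hF η hη z q (toMat Z) (toMat X) (isSymm_toMat hZs) (isSymm_toMat hX)
    (by rw [← toMat_sub]; exact posSemidef_toMat hTs hTn)).1
  have hZY : Z - Y = I := by rw [hZ]; abel
  have h2 := (hF η hη z q (toMat Z) (toMat Y) (isSymm_toMat hZs) (isSymm_toMat hY)
    (by
      rw [← toMat_sub, hZY]
      exact posSemidef_toMat hIs fun v => by rw [hIn]; positivity)).2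
  rw [← toMat_sub] at h1 h2
  rw [hZY, hI, trace_toMat_smul_id] at h2
  have h3 := inner_le_trace_toMat hTs hTn e
  rw [hTv, he] at h3
  have h4 : lam * s ≤ lam * (toMat (Z - X)).trace := by gcongr; linarith
  linarith

end FullyNonlinear

/-! ### The quadratic form of the radial penalization, and symmetrization. -/

section RadialForm

variable {H : Type*} [NormedAddCommGroup H] [InnerProductSpace ℝ H]

theorem norm_sq_sub_inner_sq_nonneg {e : H} (he : ‖e‖ = 1) (k : H) :
    0 ≤ ‖k‖ ^ 2 - ⟪e, k⟫ ^ 2 := by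
  have h := abs_real_inner_le_norm e k
  rw [he, one_mul] at h
  have := sq_le_sq' (by linarith [abs_le.1 h |>.1]) (abs_le.1 h).2
  linarith

/-- With s = ‖w + k‖ - r, t = ⟪e, k⟫ and m the squared tangential part of k, one has (s - t)(2r + s
+ t) = m. So s exceeds t by about m/(2r), and b ≤ P/r lets the tangential term absorb all errors. -/
theorem eventually_radial_le {φ : ℝ → ℝ} {w e : H} {r P b : ℝ} (hr : 0 < r) (he : ‖e‖ = 1)
    (hw : w = r • e) (hb : 0 ≤ b) (hbP : b ≤ P / r)
    (hφ : ∀ᶠ s in 𝓝 (0 : ℝ), φ (r + s) ≤ φ r + P * s - 3 / 8 * b * s ^ 2) :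
    ∀ᶠ k in 𝓝 (0 : H), φ ‖w + k‖ ≤ φ r + P * ⟪e, k⟫ - b / 4 * ⟪e, k⟫ ^ 2
      + P / r * (‖k‖ ^ 2 - ⟪e, k⟫ ^ 2) := by
  have hwn : ‖w‖ = r := by rw [hw, norm_smul, he, Real.norm_eq_abs, abs_of_pos hr, mul_one]
  have hs : Tendsto (fun k : H => ‖w + k‖ - r) (𝓝 0) (𝓝 0) := by
    have : Tendsto (fun k : H => ‖w + k‖ - r) (𝓝 0) (𝓝 (‖w + 0‖ - r)) := by
      apply Continuous.tendsto; fun_prop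
    rwa [add_zero, hwn, sub_self] at this
  filter_upwards [hs.eventually hφ, hs.eventually (Metric.ball_mem_nhds 0 (by positivity : 0 < r / 8)),
    Metric.ball_mem_nhds (0 : H) (by positivity : 0 < r / 8)] with k hk hk1 hk2
  rw [mem_ball_zero_iff] at hk2
  rw [Real.dist_eq, sub_zero, abs_lt] at hk1
  set s := ‖w + k‖ - r with hsdef
  set t := ⟪e, k⟫ with htdef
  set m := ‖k‖ ^ 2 - t ^ 2 with hm
  have hm0 : 0 ≤ m := norm_sq_sub_inner_sq_nonneg he k
  have hrs : r + s = ‖w + k‖ := by rw [hsdef]; ring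
  have ht : |t| < r / 8 := by
    refine lt_of_le_of_lt (abs_real_inner_le_norm e k) ?_
    rw [he, one_mul]; exact hk2
  rw [abs_lt] at ht
  have hsq : (r + s) ^ 2 = (r + t) ^ 2 + m := by
    rw [hrs, norm_add_sq_real, hwn, hw, real_inner_smul_left, hm]; ring
  rw [hrs] at hk
  have hst : (s - t) * (2 * r + s + t) = m := by nlinarith
  have h2 : 0 ≤ s - t := by
    by_contra! hlt
    have : 0 < 2 * r + s + t := by linarith
    nlinarith
  have h3 : (s - t) * (7 / 4 * r) ≤ m := by
    rw [← hst]; gcongr; linarith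
  have hP : 0 ≤ P / r := hb.trans hbP
  have hPr : P / r * r = P := by field_simp
  set τ := P / r with hτ
  have h4 : P * (s - t) ≤ 4 / 7 * (τ * m) := by
    rw [← hPr]; nlinarith
  have h5 : t ^ 2 - m / 7 ≤ s ^ 2 := by nlinarith [sq_nonneg (s - t)]
  have h6 : b * (t ^ 2 - m / 7) ≤ b * s ^ 2 := by gcongr
  have h7 : b * m ≤ τ * m := by gcongr
  have h8 : 0 ≤ b * t ^ 2 := by positivity
  have h9 : 0 ≤ b * m := by positivity
  nlinarith

/-- The quadratic form dominating the sup-convolved Hessian of the penalization. -/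
theorem exists_penalization_form [CompleteSpace H] (e : H) (α τ K : ℝ) :
    ∃ S : WithLp 2 (H × H) →L[ℝ] WithLp 2 (H × H), (∀ x y, ⟪S x, y⟫ = ⟪x, S y⟫) ∧
      ∀ z, 1 / 2 * ⟪S z, z⟫ = - (α / 2) * ⟪e, z.fst - z.snd⟫ ^ 2
        + 2 * τ * (‖z.fst - z.snd‖ ^ 2 - ⟪e, z.fst - z.snd⟫ ^ 2) + 2 * K * ‖z.fst‖ ^ 2 := by
  set π₁ : WithLp 2 (H × H) →L[ℝ] H := (ContinuousLinearMap.fst ℝ H H).comp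
    (WithLp.prodContinuousLinearEquiv 2 ℝ H H : WithLp 2 (H × H) →L[ℝ] H × H) with hπ₁
  set π₂ : WithLp 2 (H × H) →L[ℝ] H := (ContinuousLinearMap.snd ℝ H H).comp
    (WithLp.prodContinuousLinearEquiv 2 ℝ H H : WithLp 2 (H × H) →L[ℝ] H × H) with hπ₂
  set B : H →L[ℝ] H := (-(α + 4 * τ)) • (innerSL ℝ e).smulRight e
    + (4 * τ) • ContinuousLinearMap.id ℝ H with hB
  have hBi : ∀ x y, ⟪B x, y⟫ = -(α + 4 * τ) * (⟪e, x⟫ * ⟪e, y⟫) + 4 * τ * ⟪x, y⟫ := fun x y => by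
    simp only [hB, add_apply, smul_apply, ContinuousLinearMap.smulRight_apply,
      ContinuousLinearMap.id_apply, innerSL_apply_apply, inner_add_left, real_inner_smul_left]
  set D := π₁ - π₂ with hD
  have hDz : ∀ z, D z = z.fst - z.snd := fun z => rfl
  have hπz : ∀ z, π₁ z = z.fst := fun z => rfl
  set S := (ContinuousLinearMap.adjoint D).comp (B.comp D)
    + (4 * K) • (ContinuousLinearMap.adjoint π₁).comp π₁ with hS
  have hSi : ∀ x y, ⟪S x, y⟫ = ⟪B (D x), D y⟫ + 4 * K * ⟪π₁ x, π₁ y⟫ := fun x y => by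
    simp only [hS, add_apply, smul_apply, ContinuousLinearMap.comp_apply, inner_add_left,
      real_inner_smul_left, ContinuousLinearMap.adjoint_inner_left]
  refine ⟨S, fun x y => ?_, fun z => ?_⟩
  · rw [real_inner_comm (S y) x, hSi, hSi, hBi, hBi, real_inner_comm (D x) (D y),
      real_inner_comm (π₁ x) (π₁ y)]
    ring
  · rw [hSi, hBi, hDz, hπz, real_inner_self_eq_norm_sq, real_inner_self_eq_norm_sq]
    ring

/-- Young's inequality: moving the base point halves the negative coefficient along e, doubles the
positive ones, and costs a multiple of the squared displacement. That multiple dictates the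
sup-convolution parameter. -/
theorem penalization_le {e : H} (he : ‖e‖ = 1) {α τ K : ℝ} (hα : 0 ≤ α) (hτ : α ≤ 2 * τ)
    (hK : 0 ≤ K) (ξ η x y : H) :
    -α * ⟪e, ξ - η⟫ ^ 2 + τ * (‖ξ - η‖ ^ 2 - ⟪e, ξ - η⟫ ^ 2) + K * ‖ξ‖ ^ 2 ≤
      - (α / 2) * ⟪e, x - y⟫ ^ 2 + 2 * τ * (‖x - y‖ ^ 2 - ⟪e, x - y⟫ ^ 2) + 2 * K * ‖x‖ ^ 2
        + (4 * τ + 2 * K) * (‖x - ξ‖ ^ 2 + ‖y - η‖ ^ 2) := by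
  set d := x - y with hd
  set h₁ := x - ξ with hh₁
  set h₂ := y - η with hh₂
  have hτ0 : 0 ≤ τ := by linarith
  have e1 : ξ - η = d - (h₁ - h₂) := by rw [hd, hh₁, hh₂]; abel
  have e2 : ξ = x - h₁ := by rw [hh₁]; abel
  set h := h₁ - h₂ with hh
  rw [e1]
  have n1 := norm_sq_sub_inner_sq_nonneg he (d + h)
  have n2 := norm_sq_sub_inner_sq_nonneg he h
  rw [norm_add_sq_real, inner_add_right] at n1
  rw [norm_sub_sq_real, inner_sub_right]
  have n3 : K * ‖ξ‖ ^ 2 ≤ K * (2 * ‖x‖ ^ 2 + 2 * ‖h₁‖ ^ 2) := by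
    gcongr
    rw [e2, norm_sub_sq_real]
    have := norm_add_sq_real x h₁
    nlinarith [sq_nonneg ‖x + h₁‖]
  have n4 : ‖h‖ ^ 2 ≤ 2 * ‖h₁‖ ^ 2 + 2 * ‖h₂‖ ^ 2 := by
    rw [hh, norm_sub_sq_real]
    have := norm_add_sq_real h₁ h₂
    nlinarith [sq_nonneg ‖h₁ + h₂‖]
  have n5 := mul_le_mul_of_nonneg_left n4 (by linarith : 0 ≤ 2 * τ)
  have n6 := mul_nonneg hτ0 n1
  have n8 : 0 ≤ (2 * τ - α) * ⟪e, h⟫ ^ 2 := by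
    have : 0 ≤ 2 * τ - α := by linarith
    positivity
  have n9 : 0 ≤ α * (⟪e, d⟫ - 2 * ⟪e, h⟫) ^ 2 := by positivity
  have n10 : 0 ≤ K * ‖h₂‖ ^ 2 := by positivity
  linarith

end RadialForm

section Symmetrization

variable {H : Type*} [NormedAddCommGroup H] [InnerProductSpace ℝ H] [CompleteSpace H]

/-- The Hessians come from derivatives within a set, so their symmetry is not known. Only the
quadratic form matters; the added δ‖x‖² absorbs the ε‖k‖² error, so that test polynomials touch
exactly. -/
theorem exists_symmetric_add (X : H →L[ℝ] H) (δ : ℝ) :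
    ∃ X' : H →L[ℝ] H, (∀ x y, ⟪X' x, y⟫ = ⟪x, X' y⟫) ∧
      ∀ x, 1 / 2 * ⟪X' x, x⟫ = 1 / 2 * ⟪X x, x⟫ + δ * ‖x‖ ^ 2 := by
  set X' := (1 / 2 : ℝ) • (X + ContinuousLinearMap.adjoint X)
    + (2 * δ) • ContinuousLinearMap.id ℝ H with hX'
  have h : ∀ x y, ⟪X' x, y⟫ = 1 / 2 * (⟪X x, y⟫ + ⟪x, X y⟫) + 2 * δ * ⟪x, y⟫ := fun x y => by
    simp only [hX', add_apply, smul_apply, ContinuousLinearMap.id_apply, inner_add_left,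
      real_inner_smul_left, ContinuousLinearMap.adjoint_inner_left]
  refine ⟨X', fun x y => ?_, fun x => ?_⟩
  · rw [real_inner_comm (X' y) x, h, h, real_inner_comm x y, real_inner_comm x (X y),
      real_inner_comm (X x) y]
    ring
  · rw [h, real_inner_self_eq_norm_sq, real_inner_comm x (X x)]
    ring

end Symmetrization

/-! ### Doubling of variables. -/

namespace FullyNonlinear

variable {n : ℕ}

/-- At a local maximum of the doubled function, nearby approximate jets of a viscosity solution. -/
theorem exists_jets_of_doubling_max {Ω : Set (Eucl n)} (hΩ : IsOpen Ω) {u : Eucl n → ℝ}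
    (hu : ContinuousOn u Ω) {x₀ x₁ y₁ e : Eucl n} (hx : x₁ ∈ Ω) (hy : y₁ ∈ Ω) {φ : ℝ → ℝ}
    {r P b K : ℝ} (hr : 0 < r) (he : ‖e‖ = 1) (hw : x₁ - y₁ = r • e) (hb : 0 ≤ b) (hbP : b ≤ P / r)
    (hK : 0 ≤ K) (hφ : ∀ᶠ s in 𝓝 (0 : ℝ), φ (r + s) ≤ φ r + P * s - 3 / 8 * b * s ^ 2)
    (hmax : ∀ᶠ z in 𝓝 ((0, 0) : Eucl n × Eucl n),
      u (x₁ + z.1) - u (y₁ + z.2) - φ ‖x₁ - y₁ + (z.1 - z.2)‖ - K * ‖x₁ + z.1 - x₀‖ ^ 2 ≤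
        u x₁ - u y₁ - φ r - K * ‖x₁ - x₀‖ ^ 2) {δ : ℝ} (hδ : 0 < δ) :
    ∃ (ξ η a q : Eucl n) (X Y : Eucl n →L[ℝ] Eucl n), ‖ξ - x₁‖ ≤ δ ∧ ‖η - y₁‖ ≤ δ ∧
      ‖a - (P • e + (2 * K) • (x₁ - x₀))‖ ≤ δ ∧ ‖q - P • e‖ ≤ δ ∧
      (∀ x y, ⟪X x, y⟫ = ⟪x, X y⟫) ∧ (∀ x y, ⟪Y x, y⟫ = ⟪x, Y y⟫) ∧
      (∀ᶠ k in 𝓝 (0 : Eucl n), u (ξ + k) ≤ u ξ + ⟪a, k⟫ + 1 / 2 * ⟪X k, k⟫) ∧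
      (∀ᶠ k in 𝓝 (0 : Eucl n), u η + ⟪q, k⟫ + 1 / 2 * ⟪Y k, k⟫ ≤ u (η + k)) ∧
      (∀ v, ⟪X v, v⟫ ≤ ⟪Y v, v⟫ + (4 * K + 8 * δ) * ‖v‖ ^ 2) ∧
      ⟪X e, e⟫ + b ≤ ⟪Y e, e⟫ + (4 * K + 8 * δ) ∧
      ‖X‖ ≤ 8 * (P / r) + 4 * K + 1 + 4 * δ := by
  have hP : 0 ≤ P / r := hb.trans hbP
  set τ := P / r with hτ
  have hrad := eventually_radial_le hr he hw hb hbP hφ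
  obtain ⟨S, hS, hSz⟩ := exists_penalization_form e (b / 4) τ K
  have ht : Tendsto (fun z : Eucl n × Eucl n => z.1 - z.2) (𝓝 (0, 0)) (𝓝 0) := by
    have := (continuous_fst.sub continuous_snd).tendsto (f := fun z : Eucl n × Eucl n => z.1 - z.2)
      (0, 0)
    rwa [sub_self] at this
  obtain ⟨ρ₁, hρ₁, h₁⟩ := Metric.eventually_nhds_iff.1 (hmax.and (ht.eventually hrad))
  obtain ⟨ρ₂, hρ₂, h₂⟩ := Metric.isOpen_iff.1 hΩ x₁ hx
  obtain ⟨ρ₃, hρ₃, h₃⟩ := Metric.isOpen_iff.1 hΩ y₁ hy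
  set ρ := min (ρ₁ / 2) (min (ρ₂ / 2) (ρ₃ / 2)) with hρ
  have hρ0 : 0 < ρ := by positivity
  have hρ1 : ρ < ρ₁ := (min_le_left _ _).trans_lt (by linarith)
  have hρ2 : ρ < ρ₂ := ((min_le_right _ _).trans (min_le_left _ _)).trans_lt (by linarith)
  have hρ3 : ρ < ρ₃ := ((min_le_right _ _).trans (min_le_right _ _)).trans_lt (by linarith)
  have hc1 : ContinuousOn u (closedBall x₁ ρ) :=
    hu.mono ((closedBall_subset_ball hρ2).trans h₂)
  have hc2 : ContinuousOn (fun x => -u x) (closedBall y₁ ρ) :=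
    (hu.mono ((closedBall_subset_ball hρ3).trans h₃)).neg
  obtain ⟨ξ, η, a, b', X, Y, e1, e2, e3, e4, e5, e6, e7, e8, e9⟩ :=
    -- Here c is the displacement coefficient of `penalization_le` plus 1/2, which leaves the margin
    -- κ = 1/2.
    exists_jets_of_sum_le (p := P • e + (2 * K) • (x₁ - x₀)) (q := -(P • e)) (c := 4 * τ + 2 * K + 1 / 2)
      (κ := 1 / 2) hρ0 hc1 hc2 (by positivity) (by norm_num) hS (fun ξ η hξ hη z => by
        have hd : dist ((ξ, η) : Eucl n × Eucl n) (0, 0) < ρ₁ := by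
          rw [Prod.dist_eq, dist_zero_right, dist_zero_right]
          exact max_lt (hξ.trans_lt hρ1) (hη.trans_lt hρ1)
        obtain ⟨g1, g2⟩ := h₁ hd
        have g3 := penalization_le he (α := b / 4) (τ := τ) (by positivity) (by linarith) hK ξ η
          z.fst z.snd
        have g4 : ‖x₁ + ξ - x₀‖ ^ 2 = ‖x₁ - x₀‖ ^ 2 + 2 * ⟪x₁ - x₀, ξ⟫ + ‖ξ‖ ^ 2 := by
          rw [← norm_add_sq_real]; congr 2; abel
        simp only at g1 g2
        rw [g4] at g1
        rw [hSz, inner_neg_left, inner_add_left, real_inner_smul_left, real_inner_smul_left,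
          real_inner_smul_left]
        rw [inner_sub_right] at g2 g3
        linarith) hδ
  obtain ⟨X', hX's, hX'⟩ := exists_symmetric_add X δ
  obtain ⟨Y', hY's, hY'⟩ := exists_symmetric_add Y δ
  have hsum : ∀ k l, 1 / 2 * ⟪X' k, k⟫ + 1 / 2 * ⟪Y' l, l⟫ ≤ - (b / 4 / 2) * ⟪e, k - l⟫ ^ 2
        + 2 * τ * (‖k - l‖ ^ 2 - ⟪e, k - l⟫ ^ 2) + 2 * K * ‖k‖ ^ 2
        + 2 * δ * (‖k‖ ^ 2 + ‖l‖ ^ 2) := fun k l => by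
    have := e7 k l
    rw [hSz] at this
    simp only [WithLp.toLp_fst, WithLp.toLp_snd] at this
    rw [hX', hY']
    linarith
  have hneg : ∀ v, ⟪(-Y') v, v⟫ = -⟪Y' v, v⟫ := fun v => by rw [neg_apply, inner_neg_left]
  refine ⟨ξ, η, a, -b', X', -Y', e1, e2, e3, ?_, hX's, fun x y => ?_, ?_, ?_, fun v => ?_, ?_, ?_⟩
  · rwa [← norm_neg, show -(-b' - P • e) = b' - -(P • e) by abel]
  · rw [neg_apply, neg_apply, inner_neg_left, inner_neg_right, hY's]
  · filter_upwards [e5 δ hδ] with k hk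
    rw [hX']; linarith
  · filter_upwards [e6 δ hδ] with k hk
    rw [hneg, inner_neg_left]
    linarith [hY' k]
  -- Equal increments kill every term in k - l and leave the matrix inequality; opposite increments
  -- e, -e next pick up the whole concavity b.
  · have := hsum v v
    rw [sub_self, inner_zero_right, norm_zero] at this
    rw [hneg]
    linarith
  · have := hsum e (-e)
    rw [sub_neg_eq_add, ← two_smul ℝ e, inner_smul_right, real_inner_self_eq_norm_sq, norm_smul,
      norm_neg, he, map_neg, inner_neg_neg] at this
    rw [hneg]
    norm_num at this
    linarith
  -- The upper bound comes from the increment (v, 0), the lower one from semiconvexity of the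
  -- sup-convolution.
  · refine norm_le_of_abs_inner_le hX's (by positivity) fun v => ?_
    have k1 := e8 v
    have k2 := hX' v
    have k3 := hsum v 0
    rw [map_zero, inner_zero_left, sub_zero, norm_zero] at k3
    have k4 : 0 ≤ b * ⟪e, v⟫ ^ 2 := by positivity
    have k5 : 0 ≤ τ * ⟪e, v⟫ ^ 2 := by positivity
    have k6 : 0 ≤ τ * ‖v‖ ^ 2 := by positivity
    have k7 : 0 ≤ K * ‖v‖ ^ 2 := by positivity
    have k8 : 0 ≤ δ * ‖v‖ ^ 2 := by positivity
    have k9 : 0 ≤ ‖v‖ ^ 2 := by positivity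
    rw [abs_le]
    constructor <;> nlinarith

/-- From F(ξ, u(ξ), a, X) ≤ 0 ≤ F(η, u(η), q, Y), monotonicity replaces u(ξ) by the smaller u(η),
ellipticity compares X with Y at η, and the structure condition compares (ξ, a) with (η, q). The
jets are only approximate, but the resulting bounds are continuous and pass to the limit δ → 0. -/
theorem doubling_inequality {Ω : Set (Eucl n)} (hΩ : IsOpen Ω) {F : Nonlinearity n}
    {lam Lam mu β : ℝ} (hlam : 0 ≤ lam) (hβ : 0 < β) (hF : UniformlyElliptic Ω F lam Lam)
    (hFz : MonotoneInValue Ω F) (hFs : NaturalStructure Ω F mu β) (hmu : 0 ≤ mu) {u : Eucl n → ℝ}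
    (hu : IsViscositySolution Ω F u) {x₀ x₁ y₁ e : Eucl n} (hx : x₁ ∈ Ω) (hy : y₁ ∈ Ω)
    (hpos : u y₁ < u x₁) {φ : ℝ → ℝ}
    {r P b K : ℝ} (hr : 0 < r) (he : ‖e‖ = 1) (hw : x₁ - y₁ = r • e) (hb : 0 ≤ b) (hbP : b ≤ P / r)
    (hK : 0 ≤ K) (hφ : ∀ᶠ s in 𝓝 (0 : ℝ), φ (r + s) ≤ φ r + P * s - 3 / 8 * b * s ^ 2)
    (hmax : ∀ᶠ z in 𝓝 ((0, 0) : Eucl n × Eucl n),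
      u (x₁ + z.1) - u (y₁ + z.2) - φ ‖x₁ - y₁ + (z.1 - z.2)‖ - K * ‖x₁ + z.1 - x₀‖ ^ 2 ≤
        u x₁ - u y₁ - φ r - K * ‖x₁ - x₀‖ ^ 2) :
    lam * b ≤ Lam * (4 * K * n) + mu * (r * (1 + P + ‖P • e + (2 * K) • (x₁ - x₀)‖)
      + ‖(2 * K) • (x₁ - x₀)‖ / (1 + P + ‖P • e + (2 * K) • (x₁ - x₀)‖)) ^ β
      * (1 + P ^ 2 + ‖P • e + (2 * K) • (x₁ - x₀)‖ ^ 2 + (8 * (P / r) + 4 * K + 1)) := by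
  have hδ : ∀ k : ℕ, (0 : ℝ) < 1 / ((k : ℝ) + 1) := fun k => by positivity
  have hδt : Tendsto (fun k : ℕ => 1 / ((k : ℝ) + 1)) atTop (𝓝 0) :=
    tendsto_one_div_add_atTop_nhds_zero_nat
  choose ξ η a q X Y h1 h2 h3 h4 h5 h6 h7 h8 h9 h10 h11 using fun k : ℕ =>
    exists_jets_of_doubling_max hΩ hu.1 hx hy hr he hw hb hbP hK hφ hmax (hδ k)
  set p := P • e + (2 * K) • (x₁ - x₀) with hp
  have lim : ∀ {f : ℕ → Eucl n} {y : Eucl n}, (∀ k, ‖f k - y‖ ≤ 1 / ((k : ℝ) + 1)) →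
      Tendsto f atTop (𝓝 y) := fun {f y} hf => by
    rw [tendsto_iff_norm_sub_tendsto_zero]
    exact squeeze_zero (fun k => norm_nonneg _) hf hδt
  have lξ := lim h1
  have lη := lim h2
  have la := lim h3
  have lq := lim h4
  have hPn : ‖P • e‖ = P := by
    have hP : 0 ≤ P := by
      have : 0 ≤ P / r := hb.trans hbP
      rw [le_div_iff₀ hr] at this; linarith
    rw [norm_smul, he, mul_one, Real.norm_eq_abs, abs_of_nonneg hP]
  have lu1 : Tendsto (fun k => u (ξ k)) atTop (𝓝 (u x₁)) :=
    ((hu.1.continuousAt (hΩ.mem_nhds hx)).tendsto).comp lξ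
  have lu2 : Tendsto (fun k => u (η k)) atTop (𝓝 (u y₁)) :=
    ((hu.1.continuousAt (hΩ.mem_nhds hy)).tendsto).comp lη
  have hev : ∀ᶠ k : ℕ in atTop, lam * b - Lam * ((4 * K + 8 * (1 / ((k : ℝ) + 1))) * n) ≤
      mu * (‖η k - ξ k‖ * (1 + ‖q k‖ + ‖a k‖) + ‖q k - a k‖ / (1 + ‖q k‖ + ‖a k‖)) ^ β
        * (1 + ‖q k‖ ^ 2 + ‖a k‖ ^ 2 + (8 * (P / r) + 4 * K + 1 + 4 * (1 / ((k : ℝ) + 1)))) := by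
    filter_upwards [lξ.eventually (hΩ.mem_nhds hx), lη.eventually (hΩ.mem_nhds hy),
      lu2.eventually_lt lu1 hpos] with k hξ hη huk
    have s1 := hu.2.1.apply_jet hξ (h5 k) (h7 k)
    have s2 := hu.2.2.apply_jet hη (h6 k) (h8 k)
    have s3 := hFz (ξ k) hξ (u (η k)) (u (ξ k)) (a k) (toMat (X k)) (isSymm_toMat (h5 k)) huk.le
    have s4 := hF.le_sub hlam hη (u (η k)) (q k) (h5 k) (h6 k)
      (by have := hδ k; positivity) (h9 k) he (h10 k)
    have s5 := (le_abs_self _).trans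
      (hFs (η k) hη (ξ k) hξ (u (η k)) (q k) (a k) (toMat (X k)) (isSymm_toMat (h5 k)))
    have s6 : mu * (‖η k - ξ k‖ * (1 + ‖q k‖ + ‖a k‖) + ‖q k - a k‖ / (1 + ‖q k‖ + ‖a k‖)) ^ β
        * (1 + ‖q k‖ ^ 2 + ‖a k‖ ^ 2 + opNorm (toMat (X k))) ≤
        mu * (‖η k - ξ k‖ * (1 + ‖q k‖ + ‖a k‖) + ‖q k - a k‖ / (1 + ‖q k‖ + ‖a k‖)) ^ β
        * (1 + ‖q k‖ ^ 2 + ‖a k‖ ^ 2 + (8 * (P / r) + 4 * K + 1 + 4 * (1 / ((k : ℝ) + 1)))) := by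
      rw [opNorm_toMat]
      gcongr
      exact h11 k
    linarith
  have lL : Tendsto (fun k : ℕ => lam * b - Lam * ((4 * K + 8 * (1 / ((k : ℝ) + 1))) * n)) atTop
      (𝓝 (lam * b - Lam * ((4 * K + 8 * 0) * n))) :=
    (((hδt.const_mul 8).const_add _).mul_const _ |>.const_mul _).const_sub _
  have lden : Tendsto (fun k => 1 + ‖q k‖ + ‖a k‖) atTop (𝓝 (1 + ‖P • e‖ + ‖p‖)) :=
    (lq.norm.const_add 1).add la.norm
  have hden : (1 + ‖P • e‖ + ‖p‖) ≠ 0 := by positivity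
  have lR := ((((((lη.sub lξ).norm).mul lden).add (((lq.sub la).norm).div lden hden)).rpow_const
    (p := β) (Or.inr hβ.le)).const_mul mu).mul ((((lq.norm.pow 2).const_add 1).add (la.norm.pow 2)).add
      ((hδt.const_mul 4).const_add (8 * (P / r) + 4 * K + 1)))
  have hfin := le_of_tendsto_of_tendsto lL lR hev
  have n1 : ‖y₁ - x₁‖ = r := by
    rw [norm_sub_rev, hw, norm_smul, he, Real.norm_eq_abs, abs_of_pos hr, mul_one]
  have n2 : ‖P • e - p‖ = ‖(2 * K) • (x₁ - x₀)‖ := by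
    rw [hp, sub_add_cancel_left, norm_neg]
  rw [n1, n2, hPn] at hfin
  simp only [mul_zero, add_zero] at hfin
  linarith

end FullyNonlinear

/-- Since 3/8 < 1/2, the difference of the two sides still has second derivative -b/4 < 0 at 0, and
the second-derivative test replaces a Taylor remainder. -/
theorem eventually_le_of_hasDerivAt_of_neg {φ φ' : ℝ → ℝ} {r b : ℝ} (hb : 0 < b)
    (h₁ : ∀ᶠ ρ in 𝓝 r, HasDerivAt φ (φ' ρ) ρ) (h₂ : HasDerivAt φ' (-b) r) :
    ∀ᶠ s in 𝓝 (0 : ℝ), φ (r + s) ≤ φ r + φ' r * s - 3 / 8 * b * s ^ 2 := by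
  set f : ℝ → ℝ := fun s => φ (r + s) - φ' r * s + 3 / 8 * b * s ^ 2 with hf
  have ht : Tendsto (fun s : ℝ => r + s) (𝓝 0) (𝓝 r) := by
    have := (continuous_const.add continuous_id).tendsto (f := fun s : ℝ => r + s) 0
    rwa [add_zero] at this
  have hd : ∀ᶠ s in 𝓝 (0 : ℝ), HasDerivAt f (φ' (r + s) - φ' r + 3 / 4 * b * s) s := by
    filter_upwards [ht.eventually h₁] with s hs
    have e1 : HasDerivAt (fun s => φ (r + s)) (φ' (r + s)) s := by
      simpa using hs.comp_const_add r s
    refine ((e1.sub ((hasDerivAt_id s).const_mul (φ' r))).add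
      (((hasDerivAt_id s).pow 2).const_mul (3 / 8 * b))).congr_deriv ?_
    simp; ring
  have hdd : HasDerivAt (deriv f) (-b + 3 / 4 * b) 0 := by
    have e1 : HasDerivAt (fun s => φ' (r + s)) (-b) 0 :=
      HasDerivAt.comp_const_add r 0 (by simpa using h₂)
    have e2 : HasDerivAt (fun s => φ' (r + s) - φ' r + 3 / 4 * b * s) (-b + 3 / 4 * b) 0 := by
      refine ((e1.sub_const (φ' r)).add ((hasDerivAt_id (0 : ℝ)).const_mul (3 / 4 * b))).congr_deriv
        ?_
      simp
    exact e2.congr_of_eventuallyEq (hd.mono fun s hs => hs.deriv)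
  have hmax : IsLocalMax f 0 := by
    refine isLocalMax_of_deriv_deriv_neg ?_ ?_ hd.self_of_nhds.continuousAt
    · rw [hdd.deriv]; linarith
    · rw [hd.self_of_nhds.deriv]; simp
  filter_upwards [hmax] with s hs
  simp only [hf] at hs
  simp only [add_zero, mul_zero] at hs
  linarith

namespace FullyNonlinear

variable {n : ℕ}

/-- Division by P/r. The quadratic growth in the gradient is harmless because P² = rP·(P/r), while 1
and K are at most P/r. -/
theorem doubling_inequality_scaled {lam Lam mu β r P K σ p w : ℝ}
    (hmu : 0 ≤ mu) (hβ : 0 ≤ β) (hr : 0 < r) (hr1 : r ≤ 1) (hP : 1 ≤ P)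
    (hKr : K * r ≤ P) (hw : 0 ≤ w) (hwP : w ≤ P) (hp : 0 ≤ p) (hpw : p ≤ P + w)
    (h : lam * (σ * (P / r)) ≤ Lam * (4 * K * n) + mu * (r * (1 + P + p) + w / (1 + P + p)) ^ β
      * (1 + P ^ 2 + p ^ 2 + (8 * (P / r) + 4 * K + 1))) :
    lam * σ ≤ 4 * Lam * n * (K * r / P)
      + 13 * mu * (4 * (r * P) + w / P) ^ β * (1 + r * P) := by
  have hP0 : 0 < P := by linarith
  set τ := P / r with hτ
  have hτ0 : 0 < τ := by positivity
  have hτ1 : 1 ≤ τ := by rw [hτ, le_div_iff₀ hr]; linarith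
  have hK : K ≤ τ := by rw [hτ, le_div_iff₀ hr]; linarith
  have h1 : (r * (1 + P + p) + w / (1 + P + p)) ^ β ≤ (4 * (r * P) + w / P) ^ β := by
    refine Real.rpow_le_rpow (by positivity) ?_ hβ
    have e1 : r * (1 + P + p) ≤ r * (4 * P) := by gcongr; linarith
    have e2 : w / (1 + P + p) ≤ w / P := by gcongr; linarith
    linarith
  have hPsq : P ^ 2 = r * P * τ := by rw [hτ]; field_simp
  have h2 : 1 + P ^ 2 + p ^ 2 + (8 * τ + 4 * K + 1) ≤ 13 * (1 + r * P) * τ := by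
    have e1 : p ^ 2 ≤ (2 * P) ^ 2 := by gcongr; linarith
    have e2 : 1 ≤ P ^ 2 := by nlinarith
    have e3 : 0 ≤ r * P * τ := by positivity
    nlinarith
  have hden : 0 ≤ 4 * (r * P) + w / P := by positivity
  have h3 : mu * (r * (1 + P + p) + w / (1 + P + p)) ^ β
      * (1 + P ^ 2 + p ^ 2 + (8 * τ + 4 * K + 1)) ≤
      mu * (4 * (r * P) + w / P) ^ β * (13 * (1 + r * P) * τ) := by
    have e0 : 0 ≤ mu * (r * (1 + P + p) + w / (1 + P + p)) ^ β := by positivity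
    have e1 : mu * (r * (1 + P + p) + w / (1 + P + p)) ^ β ≤ mu * (4 * (r * P) + w / P) ^ β := by
      gcongr
    refine (mul_le_mul_of_nonneg_left h2 e0).trans ?_
    gcongr
  have hKτ : K = K * r / P * τ := by rw [hτ]; field_simp
  refine le_of_mul_le_mul_right ?_ hτ0
  have h4 : Lam * (4 * K * n) = 4 * Lam * n * (K * r / P) * τ := by
    conv_lhs => rw [hKτ]
    ring
  calc lam * σ * τ = lam * (σ * τ) := by ring
    _ ≤ _ := h
    _ ≤ _ := add_le_add h4.le h3
    _ = _ := by ring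

/-- Comparison of the oscillation of a viscosity solution with a concave modulus `φ` which is
a strict supersolution of the one-dimensional inequality obtained by doubling of variables. -/
theorem sub_le_modulus {Ω : Set (Eucl n)} (hΩ : IsOpen Ω) {F : Nonlinearity n}
    {lam Lam mu β : ℝ} (hlam : 0 ≤ lam) (hβ : 0 < β)
    (hF : UniformlyElliptic Ω F lam Lam)
    (hFz : MonotoneInValue Ω F) (hFs : NaturalStructure Ω F mu β) (hmu : 0 ≤ mu) {u : Eucl n → ℝ}
    (hu : IsViscositySolution Ω F u) {x₀ : Eucl n} {R M : ℝ} (hR : 0 < R) (hM : 0 < M)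
    (hball : closedBall x₀ R ⊆ Ω) (huM : ∀ x ∈ closedBall x₀ R, |u x| ≤ M)
    {φ P σ : ℝ → ℝ} {r₁ : ℝ} (hr₁1 : r₁ ≤ 1) (hr₁R : r₁ ≤ R / 2)
    (hφc : ContinuousOn φ (Icc 0 r₁)) (hφ0 : ∀ r ∈ Icc 0 r₁, 0 ≤ φ r)
    (hbd : ∀ ξ η, ‖ξ - x₀‖ ≤ R / 2 → ‖ξ - η‖ = r₁ → u ξ - u η ≤ φ r₁)
    (hP : ∀ r ∈ Ioo 0 r₁, 1 ≤ P r) (hσ : ∀ r ∈ Ioo 0 r₁, 0 ≤ σ r ∧ σ r ≤ 1)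
    (hφP : ∀ r ∈ Ioo 0 r₁, ∀ᶠ s in 𝓝 (0 : ℝ),
      φ (r + s) ≤ φ r + P r * s - 3 / 8 * (σ r * (P r / r)) * s ^ 2)
    (hKP : ∀ r ∈ Ioo 0 r₁, 8 * M / R ^ 2 * r ≤ P r)
    (hstrict : ∀ ξ η, ‖ξ - x₀‖ < R / 2 → ‖ξ - η‖ ∈ Ioo 0 r₁ →
      8 * M / R ^ 2 * ‖ξ - x₀‖ ^ 2 < u ξ - u η →
      ∀ r w, r = ‖ξ - η‖ → w = 2 * (8 * M / R ^ 2) * ‖ξ - x₀‖ → w ≤ P r ∧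
      4 * Lam * n * (8 * M / R ^ 2 * r / P r)
        + 13 * mu * (4 * (r * P r) + w / P r) ^ β * (1 + r * P r) < lam * σ r)
    {y : Eucl n} (hy : ‖x₀ - y‖ ≤ r₁) : u x₀ - u y ≤ φ ‖x₀ - y‖ := by
  set K := 8 * M / R ^ 2 with hK
  have hK0 : 0 < K := by positivity
  by_contra! hcon
  set Q : Set (Eucl n × Eucl n) := {z | ‖z.1 - x₀‖ ≤ R / 2 ∧ ‖z.1 - z.2‖ ≤ r₁} with hQ
  have hQball : ∀ z ∈ Q, z.1 ∈ closedBall x₀ R ∧ z.2 ∈ closedBall x₀ R := by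
    rintro z ⟨h1, h2⟩
    rw [mem_closedBall, mem_closedBall, dist_eq_norm, dist_eq_norm]
    refine ⟨by linarith, ?_⟩
    have : z.2 - x₀ = (z.1 - x₀) - (z.1 - z.2) := by abel
    rw [this]
    exact (norm_sub_le _ _).trans (by linarith)
  have hQc : IsCompact Q := by
    refine IsCompact.of_isClosed_subset
      ((isCompact_closedBall x₀ R).prod (isCompact_closedBall x₀ R)) ?_ fun z hz => hQball z hz
    exact (isClosed_le (f := fun z : Eucl n × Eucl n => ‖z.1 - x₀‖) (by fun_prop)
      continuous_const).inter (isClosed_le (f := fun z : Eucl n × Eucl n => ‖z.1 - z.2‖)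
      (by fun_prop) continuous_const)
  set f : Eucl n × Eucl n → ℝ :=
    fun z => u z.1 - u z.2 - φ ‖z.1 - z.2‖ - K * ‖z.1 - x₀‖ ^ 2 with hf
  have hfc : ContinuousOn f Q := by
    have c1 : ContinuousOn (fun z : Eucl n × Eucl n => u z.1) Q :=
      hu.1.comp continuousOn_fst fun z hz => hball (hQball z hz).1
    have c2 : ContinuousOn (fun z : Eucl n × Eucl n => u z.2) Q :=
      hu.1.comp continuousOn_snd fun z hz => hball (hQball z hz).2
    have c3 : ContinuousOn (fun z : Eucl n × Eucl n => φ ‖z.1 - z.2‖) Q :=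
      hφc.comp (Continuous.continuousOn (by fun_prop)) fun z hz => ⟨norm_nonneg _, hz.2⟩
    exact ((c1.sub c2).sub c3).sub (Continuous.continuousOn (by fun_prop))
  have hxy : (x₀, y) ∈ Q := ⟨by simp; positivity, hy⟩
  obtain ⟨⟨ξ, η⟩, hzQ, hzmax⟩ := hQc.exists_isMaxOn ⟨_, hxy⟩ hfc
  have hfpos : 0 < f (ξ, η) := by
    refine lt_of_lt_of_le ?_ (hzmax hxy)
    simp only [hf, sub_self, norm_zero]
    linarith
  have hfv : f (ξ, η) = u ξ - u η - φ ‖ξ - η‖ - K * ‖ξ - x₀‖ ^ 2 := rfl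
  set r := ‖ξ - η‖ with hr
  have hr0 : 0 ≤ r := norm_nonneg _
  have hrle : r ≤ r₁ := hzQ.2
  have hφr : 0 ≤ φ r := hφ0 r ⟨hr0, hrle⟩
  have hKx : 0 ≤ K * ‖ξ - x₀‖ ^ 2 := by positivity
  have hξΩ := hball (hQball _ hzQ).1
  have hηΩ := hball (hQball _ hzQ).2
  have huu : u η < u ξ := by linarith
  -- The maximum avoids every face of Q. At r = 0 the difference of u vanishes; at r = r₁ hypothesis
  -- `hbd` applies; at ‖ξ - x₀‖ = R/2 the penalty K(R/2)² = 2M already bounds the oscillation.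
  have hrpos : 0 < r := by
    refine norm_pos_iff.2 fun h0 => ?_
    rw [sub_eq_zero] at h0
    rw [h0] at huu
    exact lt_irrefl _ huu
  have hrlt : r < r₁ := by
    refine lt_of_le_of_ne hrle fun h0 => ?_
    have := hbd ξ η hzQ.1 h0
    rw [h0] at hfv
    linarith
  have hξlt : ‖ξ - x₀‖ < R / 2 := by
    refine lt_of_le_of_ne hzQ.1 fun h0 => ?_
    have e1 := abs_le.1 (huM ξ (hQball _ hzQ).1)
    have e2 := abs_le.1 (huM η (hQball _ hzQ).2)
    have e3 : K * ‖ξ - x₀‖ ^ 2 = 2 * M := by rw [h0, hK]; field_simp; norm_num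
    linarith
  have hrI : r ∈ Ioo 0 r₁ := ⟨hrpos, hrlt⟩
  set e := r⁻¹ • (ξ - η) with he
  have hen : ‖e‖ = 1 := by
    rw [he, norm_smul, norm_inv, Real.norm_eq_abs, abs_of_pos hrpos, ← hr,
      inv_mul_cancel₀ hrpos.ne']
  have hw : ξ - η = r • e := by rw [he, smul_inv_smul₀ hrpos.ne']
  have hPr := hP r hrI
  have hσr := hσ r hrI
  have hPr0 : 0 < P r / r := div_pos (by linarith) hrpos
  have hmax : ∀ᶠ z in 𝓝 ((0, 0) : Eucl n × Eucl n),
      u (ξ + z.1) - u (η + z.2) - φ ‖ξ - η + (z.1 - z.2)‖ - K * ‖ξ + z.1 - x₀‖ ^ 2 ≤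
        u ξ - u η - φ r - K * ‖ξ - x₀‖ ^ 2 := by
    have t1 : Tendsto (fun z : Eucl n × Eucl n => ‖ξ + z.1 - x₀‖) (𝓝 (0, 0)) (𝓝 ‖ξ - x₀‖) := by
      have : Continuous fun z : Eucl n × Eucl n => ‖ξ + z.1 - x₀‖ := by fun_prop
      simpa using this.tendsto (0, 0)
    have t2 : Tendsto (fun z : Eucl n × Eucl n => ‖ξ - η + (z.1 - z.2)‖) (𝓝 (0, 0)) (𝓝 r) := by
      have : Continuous fun z : Eucl n × Eucl n => ‖ξ - η + (z.1 - z.2)‖ := by fun_prop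
      simpa using this.tendsto (0, 0)
    filter_upwards [t1.eventually_lt_const hξlt, t2.eventually_lt_const hrlt] with z hz1 hz2
    have e1 : (ξ + z.1) - (η + z.2) = ξ - η + (z.1 - z.2) := by abel
    have hmem : (ξ + z.1, η + z.2) ∈ Q := ⟨hz1.le, by rw [e1]; exact hz2.le⟩
    have : f (ξ + z.1, η + z.2) ≤ f (ξ, η) := hzmax hmem
    simp only [hf] at this
    rwa [e1] at this
  have hwn : ‖(2 * K) • (ξ - x₀)‖ = 2 * K * ‖ξ - x₀‖ := by
    rw [norm_smul, Real.norm_eq_abs, abs_of_pos (by positivity)]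
  obtain ⟨s1, s2⟩ := hstrict ξ η hξlt hrI (by linarith) r _ rfl hwn
  have key := doubling_inequality hΩ hlam hβ hF hFz hFs hmu hu hξΩ hηΩ huu hrpos hen hw
    (mul_nonneg hσr.1 hPr0.le) (mul_le_of_le_one_left hPr0.le hσr.2) hK0.le (hφP r hrI) hmax
  refine absurd (doubling_inequality_scaled hmu hβ.le hrpos (hrle.trans hr₁1) hPr (hKP r hrI)
    (norm_nonneg _) s1 (norm_nonneg _) ?_ key) (not_le.2 s2)
  refine (norm_add_le _ _).trans ?_
  rw [norm_smul, hen, mul_one, Real.norm_eq_abs, abs_of_pos (by linarith)]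

end FullyNonlinear

/-! ### The interior Hölder estimate. -/

namespace FullyNonlinear

variable {n : ℕ}

/-- The left side is continuous in α and vanishes at α = 0, where β > 0 gives 0^β = 0. -/
theorem exists_holder_exponent {lam Lam mu β M : ℝ} (hlam : 0 < lam) (hβ : 0 < β) (N : ℝ) :
    ∃ α : ℝ, 0 < α ∧ α ≤ 1 / 4 ∧ 4 * Lam * N * (4 * α)
      + 13 * mu * ((8 * M + 4) * α) ^ β * (1 + 2 * M * α) < lam / 2 := by
  have hc : ContinuousAt (fun α : ℝ => 4 * Lam * N * (4 * α)
      + 13 * mu * ((8 * M + 4) * α) ^ β * (1 + 2 * M * α)) 0 := by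
    refine ContinuousAt.add (by fun_prop) (ContinuousAt.mul (ContinuousAt.mul (by fun_prop) ?_)
      (by fun_prop))
    exact ContinuousAt.rpow_const (by fun_prop) (Or.inr hβ.le)
  have h0 : (fun α : ℝ => 4 * Lam * N * (4 * α)
      + 13 * mu * ((8 * M + 4) * α) ^ β * (1 + 2 * M * α)) 0 < lam / 2 := by
    simp [Real.zero_rpow hβ.ne', hlam]
  have h1 := (hc.eventually_lt_const h0).filter_mono (nhdsWithin_le_nhds (s := Ioi 0))
  have h2 : ∀ᶠ α : ℝ in 𝓝[>] 0, α ∈ Ioc (0 : ℝ) (1 / 4) :=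
    Ioc_mem_nhdsGT (by norm_num)
  obtain ⟨α, h3, h4⟩ := (h1.and h2).exists
  exact ⟨α, h4.1, h4.2, h3⟩

theorem exists_lipschitz_scale {lam Lam mu β M α : ℝ} (hlam : 0 < lam) (hβ : 0 < β) (hα : 0 < α)
    (N : ℝ) : ∃ τ : ℝ, 0 < τ ∧ τ ≤ 1 / 64 ∧ 4 * Lam * N * (8 * τ)
      + 13 * mu * (16 * M * τ ^ α + 8 * τ ^ (1 / 2 : ℝ)) ^ β * (1 + 4 * M * τ ^ α)
        < lam * (α * β / 2) / 2 := by
  have hα' : ContinuousAt (fun τ : ℝ => τ ^ α) 0 :=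
    continuousAt_id.rpow_const (Or.inr hα.le)
  have hh : ContinuousAt (fun τ : ℝ => τ ^ (1 / 2 : ℝ)) 0 :=
    continuousAt_id.rpow_const (Or.inr (by norm_num))
  have hc : ContinuousAt (fun τ : ℝ => 4 * Lam * N * (8 * τ)
      + 13 * mu * (16 * M * τ ^ α + 8 * τ ^ (1 / 2 : ℝ)) ^ β * (1 + 4 * M * τ ^ α)) 0 := by
    refine ContinuousAt.add (by fun_prop) (ContinuousAt.mul (ContinuousAt.mul (by fun_prop) ?_)
      (continuousAt_const.add (continuousAt_const.mul hα')))
    exact ((continuousAt_const.mul hα').add (continuousAt_const.mul hh)).rpow_const (Or.inr hβ.le)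
  have h0 : (fun τ : ℝ => 4 * Lam * N * (8 * τ)
      + 13 * mu * (16 * M * τ ^ α + 8 * τ ^ (1 / 2 : ℝ)) ^ β * (1 + 4 * M * τ ^ α)) 0
        < lam * (α * β / 2) / 2 := by
    simp only [Real.zero_rpow hα.ne', Real.zero_rpow (by norm_num : (1 / 2 : ℝ) ≠ 0), mul_zero,
      add_zero, Real.zero_rpow hβ.ne', zero_mul]
    positivity
  have h1 := (hc.eventually_lt_const h0).filter_mono (nhdsWithin_le_nhds (s := Ioi 0))
  have h2 : ∀ᶠ τ : ℝ in 𝓝[>] 0, τ ∈ Ioc (0 : ℝ) (1 / 64) :=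
    Ioc_mem_nhdsGT (by norm_num)
  obtain ⟨τ, h3, h4⟩ := (h1.and h2).exists
  exact ⟨τ, h4.1, h4.2, h3⟩

/-- Interior Hölder estimate. -/
theorem exists_holder_estimate (n : ℕ) {lam Lam mu β M : ℝ} (hlam : 0 < lam) (hLam : lam ≤ Lam)
    (hmu : 0 < mu) (hβ : 0 < β) (hM : 1 ≤ M) :
    ∃ α : ℝ, 0 < α ∧ α ≤ 1 / 4 ∧ ∀ (Ω : Set (Eucl n)) (F : Nonlinearity n) (u : Eucl n → ℝ),
      IsOpen Ω → UniformlyElliptic Ω F lam Lam → MonotoneInValue Ω F →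
      NaturalStructure Ω F mu β → IsViscositySolution Ω F u → ∀ (x₀ : Eucl n) (R : ℝ), 0 < R →
      R ≤ 1 → closedBall x₀ R ⊆ Ω → (∀ x ∈ closedBall x₀ R, |u x| ≤ M) →
      ∀ y, ‖x₀ - y‖ ≤ α ^ 2 * R → u x₀ - u y ≤ 2 * M * (‖x₀ - y‖ / (α ^ 2 * R)) ^ α := by
  obtain ⟨α, hα, hα4, hsmall⟩ := exists_holder_exponent (Lam := Lam) (mu := mu) (M := M) hlam hβ n
  refine ⟨α, hα, hα4, fun Ω F u hΩ hF hFz hFs hu x₀ R hR hR1 hball huM y hy => ?_⟩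
  have hM0 : 0 < M := by linarith
  have hLam0 : 0 < Lam := by linarith
  -- At this scale the slope is at least 2M/(αR), so Kr/P and w/P are both at most 4α.
  set r₁ := α ^ 2 * R with hr₁
  have hr₁0 : 0 < r₁ := by positivity
  have hα2 : α ^ 2 ≤ 1 / 16 := by nlinarith
  have hr₁R : r₁ ≤ R / 2 := by rw [hr₁]; nlinarith
  set φ : ℝ → ℝ := fun r => 2 * M * (r / r₁) ^ α with hφ
  have hq : ∀ r ∈ Ioo 0 r₁, φ r ≤ 2 * M ∧ 2 * M * (r / r₁) ≤ φ r := by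
    intro r hr
    have h1 : r / r₁ ≤ 1 := (div_le_one hr₁0).2 hr.2.le
    have h0 : 0 < r / r₁ := div_pos hr.1 hr₁0
    constructor
    · have := Real.rpow_le_one h0.le h1 hα.le
      simp only [hφ]; nlinarith
    · have := Real.rpow_le_rpow_of_exponent_ge h0 h1 (by linarith : α ≤ 1)
      rw [Real.rpow_one] at this
      simp only [hφ]; gcongr
  have hKr : ∀ r ∈ Ioo 0 r₁, 8 * M / R ^ 2 * r ≤ 4 * α * (α * φ r / r) := by
    intro r hr
    have h1 := (hq r hr).2
    have h2 : 8 * M / R ^ 2 * r ≤ 8 * M * (α ^ 2 / r₁) := by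
      have : 8 * M / R ^ 2 * r ≤ 8 * M / R ^ 2 * r₁ := by have := hr.2; gcongr
      refine this.trans ?_
      rw [hr₁]
      have e1 : 8 * M / R ^ 2 * (α ^ 2 * R) = 8 * M * (α ^ 2 / R) := by field_simp
      have e2 : 8 * M * (α ^ 2 / (α ^ 2 * R)) = 8 * M * (1 / R) := by field_simp
      rw [e1, e2]
      gcongr
      linarith
    have h3 : 2 * M / r₁ ≤ φ r / r := by
      rw [le_div_iff₀ hr.1]
      calc 2 * M / r₁ * r = 2 * M * (r / r₁) := by ring
        _ ≤ _ := h1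
    calc _ ≤ 8 * M * (α ^ 2 / r₁) := h2
      _ = 4 * α * (α * (2 * M / r₁)) := by ring
      _ ≤ 4 * α * (α * (φ r / r)) := by gcongr
      _ = _ := by ring
  have hP1 : ∀ r ∈ Ioo 0 r₁, 2 * M / (α * R) ≤ α * φ r / r := by
    intro r hr
    rw [le_div_iff₀ hr.1]
    calc 2 * M / (α * R) * r = α * (2 * M * (r / r₁)) := by rw [hr₁]; field_simp
      _ ≤ α * φ r := by gcongr; exact (hq r hr).2
  refine sub_le_modulus (φ := φ) (P := fun r => α * φ r / r) (σ := fun _ => 1 - α) (r₁ := r₁) hΩ hlam.le hβ hF hFz hFs hmu.le hu hR hM0 hball huM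
    (by nlinarith) hr₁R ?_ ?_ ?_ ?_ ?_ ?_ ?_ ?_ hy
  · refine ContinuousOn.mul continuousOn_const
      (ContinuousOn.rpow_const (by fun_prop) fun r _ => Or.inr hα.le)
  · intro r hr
    have : 0 ≤ r / r₁ := div_nonneg hr.1 hr₁0.le
    simp only [hφ]; positivity
  · intro ξ η hξ hξη
    have e1 : ξ ∈ closedBall x₀ R := by rw [mem_closedBall, dist_eq_norm]; linarith
    have e2 : η ∈ closedBall x₀ R := by
      rw [mem_closedBall, dist_eq_norm]
      have : η - x₀ = (ξ - x₀) - (ξ - η) := by abel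
      rw [this]
      exact (norm_sub_le _ _).trans (by linarith)
    have e3 := abs_le.1 (huM ξ e1)
    have e4 := abs_le.1 (huM η e2)
    simp only [hφ]
    rw [div_self hr₁0.ne', Real.one_rpow]
    linarith
  · intro r hr
    refine le_trans ?_ (hP1 r hr)
    rw [le_div_iff₀ (by positivity)]
    nlinarith
  · exact fun _ _ => ⟨by linarith, by linarith⟩
  · intro r hr
    have hd : ∀ ρ : ℝ, 0 < ρ → HasDerivAt φ (α * φ ρ / ρ) ρ := by
      intro ρ hρ
      have hne : ρ / r₁ ≠ 0 := (div_pos hρ hr₁0).ne'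
      have h1 := (((hasDerivAt_id ρ).div_const r₁).rpow_const (p := α) (Or.inl hne)).const_mul (2 * M)
      refine h1.congr_deriv ?_
      simp only [id, hφ]
      rw [Real.rpow_sub_one hne]
      field_simp
    have hev : ∀ᶠ ρ in 𝓝 r, HasDerivAt φ (α * φ ρ / ρ) ρ := by
      filter_upwards [lt_mem_nhds hr.1] with ρ hρ using hd ρ hρ
    have hd2 : HasDerivAt (fun ρ => α * φ ρ / ρ) (-((1 - α) * (α * φ r / r / r))) r := by
      have hr0 : r ≠ 0 := hr.1.ne'
      refine (((hd r hr.1).const_mul α).div (hasDerivAt_id r) hr0).congr_deriv ?_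
      simp only [id]
      field_simp
      ring
    have hφr : 0 < φ r := by
      have : 0 < r / r₁ := div_pos hr.1 hr₁0
      simp only [hφ]; positivity
    have hr0 := hr.1
    have hα1 : 0 < 1 - α := by linarith
    exact eventually_le_of_hasDerivAt_of_neg (φ' := fun ρ => α * φ ρ / ρ) (by positivity) hev hd2
  · intro r hr
    refine (hKr r hr).trans ?_
    have : 0 ≤ α * φ r / r := le_trans (by positivity) (hP1 r hr)
    nlinarith
  · intro ξ η hξ hr _ r w hreq hw
    rw [← hreq] at hr
    have hr0 := hr.1
    have hPpos : 0 < α * φ r / r := lt_of_lt_of_le (by positivity) (hP1 r hr)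
    have hw0 : 0 ≤ w := by rw [hw]; positivity
    have hwP : w ≤ 4 * α * (α * φ r / r) := by
      calc w ≤ 2 * (8 * M / R ^ 2) * (R / 2) := by rw [hw]; gcongr
        _ = 4 * α * (2 * M / (α * R)) := by field_simp; norm_num
        _ ≤ _ := mul_le_mul_of_nonneg_left (hP1 r hr) (by positivity)
    have hrP : r * (α * φ r / r) = α * φ r := by field_simp
    have hφr : 0 ≤ φ r := by
      have : 0 < r / r₁ := div_pos hr.1 hr₁0
      simp only [hφ]; positivity
    refine ⟨hwP.trans (by nlinarith), ?_⟩
    rw [hrP]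
    have e1 : 8 * M / R ^ 2 * r / (α * φ r / r) ≤ 4 * α := by
      rw [div_le_iff₀ hPpos]; exact hKr r hr
    have e2 : w / (α * φ r / r) ≤ 4 * α := by rw [div_le_iff₀ hPpos]; exact hwP
    have e2' : 0 ≤ w / (α * φ r / r) := by positivity
    have e3 : α * φ r ≤ 2 * M * α := by nlinarith [(hq r hr).1]
    have e4 : (4 * (α * φ r) + w / (α * φ r / r)) ^ β ≤ ((8 * M + 4) * α) ^ β :=
      Real.rpow_le_rpow (by positivity) (by linarith) hβ.le
    have e5 : 4 * Lam * n * (8 * M / R ^ 2 * r / (α * φ r / r)) ≤ 4 * Lam * n * (4 * α) := by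
      gcongr
    have e6 : 13 * mu * (4 * (α * φ r) + w / (α * φ r / r)) ^ β * (1 + α * φ r) ≤
        13 * mu * ((8 * M + 4) * α) ^ β * (1 + 2 * M * α) := by
      gcongr
    have e7 : lam / 2 ≤ lam * (1 - α) := by nlinarith
    linarith

/-! ### The Lipschitz modulus and the interior Lipschitz estimate. -/

/-- The modulus of continuity used in the Lipschitz estimate. -/
noncomputable def lipschitzModulus (θ r₁ γ r : ℝ) : ℝ :=
  θ * (2 * (r / r₁) - (r / r₁) ^ (1 + γ))

/-- The derivative of `lipschitzModulus`. -/
noncomputable def lipschitzSlope (θ r₁ γ r : ℝ) : ℝ :=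
  θ / r₁ * (2 - (1 + γ) * (r / r₁) ^ γ)

/-- The normalized concavity `-r φ'' / φ'` of `lipschitzModulus`. -/
noncomputable def lipschitzConcavity (r₁ γ r : ℝ) : ℝ :=
  γ * (1 + γ) * (r / r₁) ^ γ / (2 - (1 + γ) * (r / r₁) ^ γ)

section Modulus

variable {θ r₁ γ r : ℝ}

theorem div_mem_of_mem_Ioo (hr₁ : 0 < r₁) (hγ : 0 < γ) (hr : r ∈ Ioo 0 r₁) :
    0 < r / r₁ ∧ r / r₁ ≤ 1 ∧ 0 < (r / r₁) ^ γ ∧ (r / r₁) ^ γ ≤ 1 := by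
  have h0 : 0 < r / r₁ := div_pos hr.1 hr₁
  have h1 : r / r₁ ≤ 1 := (div_le_one hr₁).2 hr.2.le
  exact ⟨h0, h1, by positivity, Real.rpow_le_one h0.le h1 hγ.le⟩

theorem half_le_denominator (hr₁ : 0 < r₁) (hγ : 0 < γ) (hγ8 : γ ≤ 1 / 8) (hr : r ∈ Ioo 0 r₁) :
    1 / 2 ≤ 2 - (1 + γ) * (r / r₁) ^ γ ∧ 2 - (1 + γ) * (r / r₁) ^ γ ≤ 2 := by
  obtain ⟨-, -, h1, h2⟩ := div_mem_of_mem_Ioo hr₁ hγ hr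
  constructor <;> nlinarith

theorem le_lipschitzSlope (hθ : 0 < θ) (hr₁ : 0 < r₁) (hγ : 0 < γ) (hγ8 : γ ≤ 1 / 8)
    (hr : r ∈ Ioo 0 r₁) : θ / (2 * r₁) ≤ lipschitzSlope θ r₁ γ r := by
  calc θ / (2 * r₁) = θ / r₁ * (1 / 2) := by field_simp
    _ ≤ _ := by
      unfold lipschitzSlope
      gcongr
      exact (half_le_denominator hr₁ hγ hγ8 hr).1

theorem mul_lipschitzSlope_le (hθ : 0 < θ) (hr₁ : 0 < r₁) (hγ : 0 < γ) (hγ8 : γ ≤ 1 / 8)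
    (hr : r ∈ Ioo 0 r₁) : r * lipschitzSlope θ r₁ γ r ≤ 2 * θ * (r / r₁) := by
  have h0 := (div_mem_of_mem_Ioo hr₁ hγ hr).1
  calc r * lipschitzSlope θ r₁ γ r = θ * (r / r₁) * (2 - (1 + γ) * (r / r₁) ^ γ) := by
        unfold lipschitzSlope; field_simp
    _ ≤ θ * (r / r₁) * 2 := by
        gcongr
        exact (half_le_denominator hr₁ hγ hγ8 hr).2
    _ = _ := by ring

theorem lipschitzConcavity_bounds (hr₁ : 0 < r₁) (hγ : 0 < γ) (hγ8 : γ ≤ 1 / 8)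
    (hr : r ∈ Ioo 0 r₁) : γ * (r / r₁) ^ γ / 2 ≤ lipschitzConcavity r₁ γ r ∧
      lipschitzConcavity r₁ γ r ≤ 1 := by
  obtain ⟨h0, h1, h2, h3⟩ := div_mem_of_mem_Ioo hr₁ hγ hr
  obtain ⟨h4, h5⟩ := half_le_denominator hr₁ hγ hγ8 hr
  unfold lipschitzConcavity
  generalize (r / r₁) ^ γ = t at *
  constructor
  · rw [div_le_div_iff₀ (by norm_num) (by linarith)]
    have e1 : γ * t * (2 - (1 + γ) * t) ≤ γ * t * 2 := by gcongr
    have e2 : 0 ≤ γ * γ * t := by positivity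
    nlinarith
  · rw [div_le_one (by linarith)]
    nlinarith

theorem eventually_lipschitzModulus_le (hθ : 0 < θ) (hr₁ : 0 < r₁) (hγ : 0 < γ) (hγ8 : γ ≤ 1 / 8)
    (hr : r ∈ Ioo 0 r₁) : ∀ᶠ s in 𝓝 (0 : ℝ), lipschitzModulus θ r₁ γ (r + s) ≤
      lipschitzModulus θ r₁ γ r + lipschitzSlope θ r₁ γ r * s
        - 3 / 8 * (lipschitzConcavity r₁ γ r * (lipschitzSlope θ r₁ γ r / r)) * s ^ 2 := by
  obtain ⟨h0, h1, h2, h3⟩ := div_mem_of_mem_Ioo hr₁ hγ hr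
  obtain ⟨h4, h5⟩ := half_le_denominator hr₁ hγ hγ8 hr
  have hr0 := hr.1
  have hev : ∀ᶠ ρ in 𝓝 r, HasDerivAt (lipschitzModulus θ r₁ γ) (lipschitzSlope θ r₁ γ ρ) ρ := by
    filter_upwards [lt_mem_nhds hr.1] with ρ hρ
    have hne : ρ / r₁ ≠ 0 := (div_pos hρ hr₁).ne'
    have e1 := (hasDerivAt_id ρ).div_const r₁
    refine (((e1.const_mul 2).sub (e1.rpow_const (p := 1 + γ) (Or.inl hne))).const_mul
      θ).congr_deriv ?_
    simp only [id, lipschitzSlope, add_sub_cancel_left]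
    ring
  have hd2 : HasDerivAt (lipschitzSlope θ r₁ γ)
      (-(lipschitzConcavity r₁ γ r * (lipschitzSlope θ r₁ γ r / r))) r := by
    have e1 := (hasDerivAt_id r).div_const r₁
    refine ((((e1.rpow_const (p := γ) (Or.inl h0.ne')).const_mul (1 + γ)).const_sub 2).const_mul
      (θ / r₁)).congr_deriv ?_
    have hden0 : 2 - (1 + γ) * (r / r₁) ^ γ ≠ 0 := by linarith
    simp only [id, lipschitzSlope, lipschitzConcavity]
    rw [Real.rpow_sub_one h0.ne']
    generalize (r / r₁) ^ γ = t at *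
    field_simp
  have hP := lt_of_lt_of_le (by positivity) (le_lipschitzSlope hθ hr₁ hγ hγ8 hr)
  have hσ := lt_of_lt_of_le (by positivity) (lipschitzConcavity_bounds hr₁ hγ hγ8 hr).1
  exact eventually_le_of_hasDerivAt_of_neg (by positivity) hev hd2

end Modulus

/-- Every term on the left carries a factor ρ^γ: 4t + w is O(ρ^(α/2)), whose power β is ρ^γ. What
remains is `hsmall`. -/
theorem lipschitz_strict_ineq {lam Lam mu β M α τ N γ ρ k t w σ : ℝ} (hlam : 0 < lam)
    (hLam : 0 ≤ Lam) (hN : 0 ≤ N) (hmu : 0 < mu) (hβ : 0 < β) (hM : 0 < M)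
    (hα1 : α ≤ 1) (hτ : 0 < τ) (hγ : γ = α * β / 2)
    (hsmall : 4 * Lam * N * (8 * τ)
      + 13 * mu * (16 * M * τ ^ α + 8 * τ ^ (1 / 2 : ℝ)) ^ β * (1 + 4 * M * τ ^ α)
        < lam * γ / 2)
    (hρ0 : 0 < ρ) (hρ1 : ρ ≤ 1) (hσ : γ * ρ ^ γ / 2 ≤ σ) (ht : 0 ≤ t) (hw0 : 0 ≤ w)
    (hk : k ≤ 8 * τ * ρ ^ γ) (hw : w ≤ 8 * τ ^ (1 / 2 : ℝ) * ρ ^ (α / 2))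
    (f3 : t ≤ 4 * M * τ ^ α * ρ) :
    4 * Lam * N * k + 13 * mu * (4 * t + w) ^ β * (1 + t) < lam * σ := by
  have hρρ : ρ ≤ ρ ^ (α / 2) := by
    have := Real.rpow_le_rpow_of_exponent_ge hρ0 hρ1 (by linarith : α / 2 ≤ 1)
    rwa [Real.rpow_one] at this
  have hργ0 : 0 < ρ ^ γ := by positivity
  have hρα0 : 0 ≤ ρ ^ (α / 2) := by positivity
  have hA0 : 0 < τ ^ α := by positivity
  have hB0 : 0 ≤ τ ^ (1 / 2 : ℝ) := by positivity
  have f3' : t ≤ 4 * M * τ ^ α * ρ ^ (α / 2) :=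
    f3.trans (mul_le_mul_of_nonneg_left hρρ (by positivity))
  have f4 : t ≤ 4 * M * τ ^ α := f3.trans (mul_le_of_le_one_right (by positivity) hρ1)
  have f5 : (4 * t + w) ^ β ≤ (16 * M * τ ^ α + 8 * τ ^ (1 / 2 : ℝ)) ^ β * ρ ^ γ := by
    have : ρ ^ γ = (ρ ^ (α / 2)) ^ β := by
      rw [← Real.rpow_mul hρ0.le, hγ]; congr 1; ring
    rw [this, ← Real.mul_rpow (by positivity) hρα0]
    refine Real.rpow_le_rpow (by positivity) ?_ hβ.le
    linarith
  have f6 : 4 * Lam * N * k ≤ 4 * Lam * N * (8 * τ * ρ ^ γ) :=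
    mul_le_mul_of_nonneg_left hk (by positivity)
  have f7 : 13 * mu * (4 * t + w) ^ β * (1 + t) ≤
      13 * mu * ((16 * M * τ ^ α + 8 * τ ^ (1 / 2 : ℝ)) ^ β * ρ ^ γ) * (1 + 4 * M * τ ^ α) := by
    refine mul_le_mul (mul_le_mul_of_nonneg_left f5 (by positivity)) (by linarith) (by positivity)
      (by positivity)
  have f9 : lam * (γ * ρ ^ γ / 2) ≤ lam * σ := mul_le_mul_of_nonneg_left hσ hlam.le
  have f10 := mul_lt_mul_of_pos_right hsmall hργ0
  linarith

/-- The modulus `lipschitzModulus` is a strict supersolution of the inequality obtained by doubling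
of variables, given a Hölder bound of exponent `α`. -/
theorem lipschitz_strict_supersolution {lam Lam mu β M α τ N R r₁ θ γ r w P K σ ρ : ℝ}
    (hlam : 0 < lam) (hLam : 0 ≤ Lam)
    (hN : 0 ≤ N) (hmu : 0 < mu) (hβ : 0 < β) (hM : 1 ≤ M) (hα : 0 < α) (hα4 : α ≤ 1 / 4)
    (hτ : 0 < τ) (hτ64 : τ ≤ 1 / 64) (hγ : γ = α * β / 2) (hγ1 : γ ≤ 1)
    (hθ : θ = 2 * M * τ ^ α) (hr₁ : 0 < r₁) (hK : K = 8 * M / R ^ 2) (hR : 0 < R)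
    (hKr₁ : 2 * M * r₁ ^ 2 ≤ τ * θ * R ^ 2)
    (hsmall : 4 * Lam * N * (8 * τ)
      + 13 * mu * (16 * M * τ ^ α + 8 * τ ^ (1 / 2 : ℝ)) ^ β * (1 + 4 * M * τ ^ α)
        < lam * γ / 2)
    (hρ : ρ = r / r₁) (hρ0 : 0 < ρ) (hρ1 : ρ ≤ 1) (hP : θ / (2 * r₁) ≤ P)
    (hrP : r * P ≤ 2 * θ * ρ) (hσ : γ * ρ ^ γ / 2 ≤ σ) (hw0 : 0 ≤ w)
    (hw : w ^ 2 ≤ 4 * K * (θ * ρ ^ α)) :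
    K * r ≤ P ∧ w ≤ P ∧
      4 * Lam * N * (K * r / P) + 13 * mu * (4 * (r * P) + w / P) ^ β * (1 + r * P) < lam * σ := by
  have hM0 : 0 < M := by linarith
  have hταp : 0 < τ ^ α := by positivity
  have hθ0 : 0 < θ := by rw [hθ]; positivity
  have hP0 : 0 < P := lt_of_lt_of_le (by positivity) hP
  have hr0 : 0 < r := by
    have : r = ρ * r₁ := by rw [hρ]; field_simp
    rw [this]; positivity
  have hK0 : 0 < K := by rw [hK]; positivity
  have hKr₁' : K * r₁ ^ 2 ≤ 4 * τ * θ := by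
    rw [hK, div_mul_eq_mul_div, div_le_iff₀ (by positivity)]
    linarith
  have hγ0 : 0 < γ := by rw [hγ]; positivity
  have hKr : K * r ≤ 8 * τ * ρ * P := by
    refine le_trans ?_ (mul_le_mul_of_nonneg_left hP (by positivity))
    have e1 : K * r = K * r₁ ^ 2 * (ρ / r₁) := by rw [hρ]; field_simp
    have e2 : 8 * τ * ρ * (θ / (2 * r₁)) = 4 * τ * θ * (ρ / r₁) := by field_simp; norm_num
    rw [e1, e2]
    gcongr
  have hτh : (τ ^ (1 / 2 : ℝ)) ^ 2 = τ := by
    rw [← Real.rpow_natCast, ← Real.rpow_mul hτ.le]; norm_num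
  have hρh : (ρ ^ (α / 2)) ^ 2 = ρ ^ α := by
    rw [← Real.rpow_natCast, ← Real.rpow_mul hρ0.le]; congr 1; push_cast; ring
  have hwP : w ≤ 8 * τ ^ (1 / 2 : ℝ) * ρ ^ (α / 2) * P := by
    refine le_trans ?_ (mul_le_mul_of_nonneg_left hP (by positivity))
    refine (pow_le_pow_iff_left₀ hw0 (by positivity) two_ne_zero).1 (hw.trans ?_)
    have e1 : (8 * τ ^ (1 / 2 : ℝ) * ρ ^ (α / 2) * (θ / (2 * r₁))) ^ 2 =
        4 * (4 * τ * θ) / r₁ ^ 2 * (θ * ρ ^ α) := by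
      rw [mul_pow, mul_pow, mul_pow, hτh, hρh, div_pow]; field_simp; norm_num
    rw [e1]
    gcongr
    rw [le_div_iff₀ (by positivity)]
    linarith
  have hτh8 : τ ^ (1 / 2 : ℝ) ≤ 1 / 8 := by
    refine (pow_le_pow_iff_left₀ (by positivity) (by positivity) two_ne_zero).1 ?_
    rw [hτh]; linarith
  have hτh0 : 0 ≤ τ ^ (1 / 2 : ℝ) := by positivity
  have hρα0 : 0 ≤ ρ ^ (α / 2) := by positivity
  have hρα : ρ ^ (α / 2) ≤ 1 := Real.rpow_le_one hρ0.le hρ1 (by positivity)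
  have hργ0 : 0 < ρ ^ γ := by positivity
  have hργ : ρ ≤ ρ ^ γ := by
    have := Real.rpow_le_rpow_of_exponent_ge hρ0 hρ1 hγ1
    rwa [Real.rpow_one] at this
  refine ⟨hKr.trans (mul_le_of_le_one_left hP0.le (by nlinarith)),
    hwP.trans (mul_le_of_le_one_left hP0.le (by nlinarith)), ?_⟩
  have ht : 0 < r * P := by positivity
  refine lipschitz_strict_ineq hlam hLam hN hmu hβ hM0 (by linarith) hτ hγ hsmall hρ0 hρ1 hσ
    ht.le (div_nonneg hw0 hP0.le) ?_ ?_ (hrP.trans_eq (by rw [hθ]; ring))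
  · rw [div_le_iff₀ hP0]
    exact hKr.trans (by gcongr)
  · rw [div_le_iff₀ hP0]; exact hwP

/-- Both bounds rest on τ ≤ τ^α. For r₁ = τα²R and θ = 2Mτ^α they say that the slope is at least 1
and that Kr₁² ≤ 4τθ. -/
theorem lipschitz_scale_bounds {M τ α R : ℝ} (hM : 1 ≤ M) (hτ : 0 < τ) (hτ1 : τ ≤ 1) (hα : 0 < α)
    (hα1 : α ≤ 1) (hR : 0 < R) (hR1 : R ≤ 1) :
    1 ≤ 2 * M * τ ^ α / (2 * (τ * α ^ 2 * R)) ∧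
      2 * M * (τ * α ^ 2 * R) ^ 2 ≤ τ * (2 * M * τ ^ α) * R ^ 2 := by
  have hM0 : 0 < M := by linarith
  have hτα : τ ≤ τ ^ α := by
    have := Real.rpow_le_rpow_of_exponent_ge hτ hτ1 hα1
    rwa [Real.rpow_one] at this
  have hα2 : α ^ 2 ≤ 1 := pow_le_one₀ hα.le hα1
  constructor
  · rw [le_div_iff₀ (by positivity), one_mul]
    calc 2 * (τ * α ^ 2 * R) ≤ 2 * (τ * 1 * 1) := by gcongr
      _ = 2 * 1 * τ := by ring
      _ ≤ _ := by gcongr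
  · have e5 : (τ * α ^ 2) ^ 2 ≤ τ * τ ^ α := by
      calc (τ * α ^ 2) ^ 2 = τ * (τ * (α ^ 2) ^ 2) := by ring
        _ ≤ τ * (τ ^ α * 1) := by
          gcongr
          exact pow_le_one₀ (by positivity) hα2
        _ = _ := by ring
    calc 2 * M * (τ * α ^ 2 * R) ^ 2 = 2 * M * R ^ 2 * (τ * α ^ 2) ^ 2 := by ring
      _ ≤ 2 * M * R ^ 2 * (τ * τ ^ α) := by gcongr
      _ = _ := by ring

/-- Interior one-sided Lipschitz estimate. -/
theorem exists_lipschitz_estimate (n : ℕ) {lam Lam mu β M : ℝ} (hlam : 0 < lam) (hLam : lam ≤ Lam)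
    (hmu : 0 < mu) (hβ : 0 < β) (hβ1 : β ≤ 1) (hM : 1 ≤ M) :
    ∃ C ε : ℝ, 0 < C ∧ 0 < ε ∧ ∀ (Ω : Set (Eucl n)) (F : Nonlinearity n) (u : Eucl n → ℝ),
      IsOpen Ω → UniformlyElliptic Ω F lam Lam → MonotoneInValue Ω F →
      NaturalStructure Ω F mu β → IsViscositySolution Ω F u → ∀ (x₀ : Eucl n) (R : ℝ), 0 < R →
      R ≤ 1 → closedBall x₀ (2 * R) ⊆ Ω → (∀ x ∈ closedBall x₀ (2 * R), |u x| ≤ M) →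
      ∀ y, ‖x₀ - y‖ ≤ ε * R → u x₀ - u y ≤ C / R * ‖x₀ - y‖ := by
  obtain ⟨α, hα, hα4, hold⟩ := exists_holder_estimate n hlam hLam hmu hβ hM
  obtain ⟨τ, hτ, hτ64, hsmall⟩ :=
    exists_lipschitz_scale (Lam := Lam) (mu := mu) (M := M) hlam hβ hα n
  -- This is the Hölder bound at distance r₁ = τα²R, and also the value of the modulus at r₁, so the
  -- face r = r₁ is controlled.
  obtain ⟨θ, hθ⟩ : ∃ θ, θ = 2 * M * τ ^ α := ⟨_, rfl⟩
  have hM0 : 0 < M := by linarith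
  have hθ0 : 0 < θ := by rw [hθ]; positivity
  refine ⟨2 * θ / (τ * α ^ 2), τ * α ^ 2, by positivity, by positivity,
    fun Ω F u hΩ hF hFz hFs hu x₀ R hR hR1 hball huM y hy => ?_⟩
  have hLam0 : 0 ≤ Lam := by linarith
  obtain ⟨hPone, hKr₁⟩ := lipschitz_scale_bounds hM hτ (by linarith) hα (by linarith) hR hR1
  rw [← hθ] at hPone hKr₁
  obtain ⟨r₁, hr₁⟩ : ∃ r₁, r₁ = τ * α ^ 2 * R := ⟨_, rfl⟩
  rw [← hr₁] at hPone hKr₁ hy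
  have hr₁0 : 0 < r₁ := by rw [hr₁]; positivity
  have hr₁τR : r₁ ≤ τ * R := by
    rw [hr₁]
    have : α ^ 2 ≤ 1 := by nlinarith
    gcongr
    exact mul_le_of_le_one_right hτ.le this
  have hr₁R : r₁ ≤ R / 2 := by nlinarith
  obtain ⟨γ, hγ⟩ : ∃ γ, γ = α * β / 2 := ⟨_, rfl⟩
  rw [← hγ] at hsmall
  have hγ0 : 0 < γ := by rw [hγ]; positivity
  have hγ8 : γ ≤ 1 / 8 := by rw [hγ]; nlinarith
  -- The Hölder estimate is centred at the moving point ξ, which is why u must be controlled on the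
  -- ball of radius 2R.
  have hosc : ∀ ξ η, ‖ξ - x₀‖ ≤ R / 2 → ‖ξ - η‖ ≤ r₁ → u ξ - u η ≤ θ * (‖ξ - η‖ / r₁) ^ α := by
    intro ξ η hξ hξη
    have hsub : closedBall ξ R ⊆ closedBall x₀ (2 * R) := by
      apply closedBall_subset_closedBall'
      rw [dist_eq_norm]; linarith
    refine (hold Ω F u hΩ hF hFz hFs hu ξ R hR hR1 (hsub.trans hball)
      (fun x hx => huM x (hsub hx)) η (hξη.trans ?_)).trans_eq ?_
    · rw [hr₁, mul_assoc]
      exact mul_le_of_le_one_left (by positivity) (by linarith)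
    · rw [hθ, mul_assoc (2 * M), ← Real.mul_rpow hτ.le (by positivity)]
      congr 2
      rw [hr₁]; field_simp
  have hsub : closedBall x₀ R ⊆ closedBall x₀ (2 * R) :=
    closedBall_subset_closedBall (by linarith)
  have hstrict := fun r (hr : r ∈ Ioo 0 r₁) (w : ℝ) =>
    have hρ := div_mem_of_mem_Ioo hr₁0 hγ0 hr
    lipschitz_strict_supersolution (w := w) hlam hLam0 (Nat.cast_nonneg n) hmu hβ hM hα hα4 hτ hτ64
      hγ (by linarith) hθ hr₁0 rfl hR hKr₁ hsmall rfl hρ.1 hρ.2.1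
      (le_lipschitzSlope hθ0 hr₁0 hγ0 hγ8 hr) (mul_lipschitzSlope_le hθ0 hr₁0 hγ0 hγ8 hr)
      (lipschitzConcavity_bounds hr₁0 hγ0 hγ8 hr).1
  have hmain : u x₀ - u y ≤ lipschitzModulus θ r₁ γ ‖x₀ - y‖ := by
    refine sub_le_modulus (P := lipschitzSlope θ r₁ γ) (σ := lipschitzConcavity r₁ γ) hΩ hlam.le hβ
      hF hFz hFs hmu.le hu hR hM0 (hsub.trans hball) (fun x hx => huM x (hsub hx)) (by linarith)
      hr₁R ?_ ?_ ?_ ?_ ?_ ?_ ?_ ?_ hy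
    · exact ContinuousOn.mul continuousOn_const (ContinuousOn.sub (by fun_prop)
        (ContinuousOn.rpow_const (by fun_prop) fun r _ => Or.inr (by positivity)))
    · intro r hr
      have h0 : 0 ≤ r / r₁ := div_nonneg hr.1 hr₁0.le
      have h1 : r / r₁ ≤ 1 := (div_le_one hr₁0).2 hr.2
      have h2 := Real.rpow_le_rpow_of_exponent_ge' h0 h1 zero_le_one (by linarith : 1 ≤ 1 + γ)
      rw [Real.rpow_one] at h2
      exact mul_nonneg hθ0.le (by linarith)
    · intro ξ η hξ hξη
      have := hosc ξ η hξ hξη.le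
      rw [hξη, div_self hr₁0.ne', Real.one_rpow] at this
      rw [lipschitzModulus, div_self hr₁0.ne', Real.one_rpow]
      linarith
    · exact fun r hr => hPone.trans (le_lipschitzSlope hθ0 hr₁0 hγ0 hγ8 hr)
    · intro r hr
      have h := lipschitzConcavity_bounds hr₁0 hγ0 hγ8 hr
      have h2 := (div_mem_of_mem_Ioo hr₁0 hγ0 hr).2.2.1
      exact ⟨le_trans (by positivity) h.1, h.2⟩
    · exact fun r hr => eventually_lipschitzModulus_le hθ0 hr₁0 hγ0 hγ8 hr
    · intro r hr
      have hr0 := (div_mem_of_mem_Ioo hr₁0 hγ0 hr).1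
      exact (hstrict r hr 0 le_rfl (by rw [zero_pow two_ne_zero]; positivity)).1
    · intro ξ η hξ hr hlt r w hreq hw
      have hos := hosc ξ η hξ.le hr.2.le
      rw [← hreq] at hr hos
      refine (hstrict r hr w (by rw [hw]; positivity) ?_).2
      have e2 : w ^ 2 = 4 * (8 * M / R ^ 2) * (8 * M / R ^ 2 * ‖ξ - x₀‖ ^ 2) := by
        rw [hw]; ring
      rw [e2]
      exact mul_le_mul_of_nonneg_left (by linarith) (by positivity)
  refine hmain.trans ?_
  have h0 : 0 ≤ (‖x₀ - y‖ / r₁) ^ (1 + γ) := by positivity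
  calc θ * (2 * (‖x₀ - y‖ / r₁) - (‖x₀ - y‖ / r₁) ^ (1 + γ)) ≤ θ * (2 * (‖x₀ - y‖ / r₁)) := by
        gcongr; linarith
    _ = _ := by rw [hr₁]; field_simp

end FullyNonlinear

/-! ### Distance to the boundary and the final estimates. -/

/-- The ball misses the frontier, so a point outside Ω would split it between the interior of Ω and
the complement of its closure, against connectedness. -/
theorem ball_infDist_frontier_subset {E : Type*} [NormedAddCommGroup E] [NormedSpace ℝ E]
    {Ω : Set E} {x : E} (hx : x ∈ Ω) : ball x (infDist x (frontier Ω)) ⊆ Ω := by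
  intro y hy
  by_contra hyΩ
  have hpc : IsPreconnected (ball x (infDist x (frontier Ω))) := (convex_ball x _).isPreconnected
  have hx0 : x ∈ ball x (infDist x (frontier Ω)) :=
    mem_ball_self (dist_nonneg.trans_lt (mem_ball.1 hy))
  have hnf : ∀ z ∈ ball x (infDist x (frontier Ω)), z ∈ closure Ω → z ∈ interior Ω := by
    intro z hz hzc
    by_contra hzi
    exact absurd (infDist_le_dist_of_mem (x := x) (show z ∈ frontier Ω from ⟨hzc, hzi⟩))
      (not_le.2 (by rw [dist_comm]; exact hz))
  obtain ⟨z, -, hz1, hz2⟩ := hpc (interior Ω) (closure Ω)ᶜ isOpen_interior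
    isClosed_closure.isOpen_compl
    (fun z hz => (em (z ∈ closure Ω)).imp (hnf z hz) id)
    ⟨x, hx0, hnf x hx0 (subset_closure hx)⟩
    ⟨y, hy, fun h => hyΩ (interior_subset (hnf y hy h))⟩
  exact hz2 (interior_subset_closure hz1)

theorem frontier_nonempty_of_isBounded {E : Type*} [NormedAddCommGroup E] [NormedSpace ℝ E]
    [Nontrivial E] {Ω : Set E} (hΩ : Bornology.IsBounded Ω) (hne : Ω.Nonempty) :
    (frontier Ω).Nonempty := by
  rw [nonempty_frontier_iff]
  refine ⟨hne, fun h => ?_⟩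
  rw [h] at hΩ
  exact NormedSpace.unbounded_univ ℝ E hΩ

theorem infDist_frontier_le_diam {E : Type*} [PseudoMetricSpace E] {Ω : Set E}
    (hΩ : Bornology.IsBounded Ω) {x : E} (hx : x ∈ Ω) (hne : (frontier Ω).Nonempty) :
    infDist x (frontier Ω) ≤ diam Ω := by
  obtain ⟨z, hz⟩ := hne
  refine (infDist_le_dist_of_mem hz).trans ?_
  rw [← diam_closure]
  exact dist_le_diam_of_mem hΩ.closure (subset_closure hx) (frontier_subset_closure hz)

namespace FullyNonlinear

/-- Continuity bounds u on a compact ball, so the one-sided estimate holds with common constants at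
every nearby centre; exchanging the two points gives the absolute value. -/
theorem locallyLipschitzOn_of_isViscositySolution {n : ℕ} {lam Lam mu β : ℝ} (hlam : 0 < lam)
    (hLam : lam ≤ Lam) (hmu : 0 < mu) (hβ0 : 0 < β) (hβ1 : β ≤ 1) {Ω : Set (Eucl n)}
    {F : Nonlinearity n} {u : Eucl n → ℝ} (hΩ : IsOpen Ω)
    (hF : UniformlyElliptic Ω F lam Lam) (hFz : MonotoneInValue Ω F)
    (hFs : NaturalStructure Ω F mu β) (hu : IsViscositySolution Ω F u) :
    LocallyLipschitzOn Ω u := by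
  intro x₀ hx₀
  obtain ⟨ρ, hρ, hball⟩ := Metric.isOpen_iff.1 hΩ x₀ hx₀
  set R := min 1 (ρ / 8) with hRdef
  have hR : 0 < R := by positivity
  have hR1 : R ≤ 1 := min_le_left _ _
  have hRρ : R ≤ ρ / 8 := min_le_right _ _
  have hsub : closedBall x₀ (4 * R) ⊆ Ω :=
    (closedBall_subset_ball (by linarith)).trans hball
  obtain ⟨M₀, hM₀⟩ := (isCompact_closedBall x₀ (4 * R)).exists_bound_of_continuousOn
    (hu.1.mono hsub)
  obtain ⟨C, ε, hC, hε, hest⟩ :=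
    exists_lipschitz_estimate n hlam hLam hmu hβ0 hβ1 (le_max_right M₀ 1)
  set r := min R (ε * R / 2) with hr
  have hr0 : 0 < r := by positivity
  have hrR : r ≤ R := min_le_left _ _
  have hrε : r ≤ ε * R / 2 := min_le_right _ _
  have hone : ∀ x ∈ ball x₀ r, ∀ y ∈ ball x₀ r, u x - u y ≤ C / R * ‖x - y‖ := by
    intro x hx y hy
    have hs : closedBall x (2 * R) ⊆ closedBall x₀ (4 * R) := by
      apply closedBall_subset_closedBall'
      have := mem_ball.1 hx
      linarith
    refine hest Ω F u hΩ hF hFz hFs hu x R hR hR1 (hs.trans hsub)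
      (fun z hz => (hM₀ z (hs hz)).trans (le_max_left _ _)) y ?_
    rw [← dist_eq_norm]
    have h1 := dist_triangle_right x y x₀
    have h2 := mem_ball.1 hx
    have h3 := mem_ball.1 hy
    linarith
  refine ⟨Real.toNNReal (C / R), ball x₀ r, mem_nhdsWithin_of_mem_nhds (ball_mem_nhds x₀ hr0),
    LipschitzOnWith.of_dist_le_mul fun x hx y hy => ?_⟩
  rw [Real.coe_toNNReal _ (by positivity), Real.dist_eq, dist_eq_norm, abs_le]
  have h1 := hone x hx y hy
  have h2 := hone y hy x hx
  rw [norm_sub_rev] at h2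
  constructor <;> linarith

theorem exists_global_lipschitz_constant (n : ℕ) {lam Lam mu β : ℝ} (hlam : 0 < lam)
    (hLam : lam ≤ Lam) (hmu : 0 < mu) (hβ0 : 0 < β) (hβ1 : β ≤ 1) (M D : ℝ) :
    ∃ C : ℝ, 0 < C ∧ ∀ (Ω : Set (Eucl n)) (F : Nonlinearity n) (u : Eucl n → ℝ),
      IsOpen Ω → Bornology.IsBounded Ω → diam Ω ≤ D → UniformlyElliptic Ω F lam Lam →
      MonotoneInValue Ω F → NaturalStructure Ω F mu β → IsViscositySolution Ω F u →
      (∀ x ∈ Ω, |u x| ≤ M) →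
      ∀ x ∈ Ω, ∀ y ∈ Ω, |u x - u y| ≤ C / boundaryDist Ω x y * ‖x - y‖ := by
  obtain ⟨C, ε, hC, hε, hest⟩ :=
    exists_lipschitz_estimate n hlam hLam hmu hβ0 hβ1 (le_max_right M 1)
  set M' := max M 1 with hM'
  have hM'0 : 0 < M' := by positivity
  set D' := max D 0 with hD'
  have hD'0 : 0 ≤ D' := le_max_right _ _
  -- C serves pairs with ‖x - y‖ ≤ εR and 2M'/ε the remaining pairs, where boundedness suffices;
  -- 4(D' + 1) is the ratio d/R.
  refine ⟨4 * (D' + 1) * (C + 2 * M' / ε), by positivity,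
    fun Ω F u hΩ hΩb hdiam hF hFz hFs hu huM => ?_⟩
  suffices hone : ∀ x ∈ Ω, ∀ y ∈ Ω, x ≠ y →
      u x - u y ≤ 4 * (D' + 1) * (C + 2 * M' / ε) / boundaryDist Ω x y * ‖x - y‖ by
    intro x hx y hy
    by_cases hxy : x = y
    · subst hxy; simp
    have h1 := hone x hx y hy hxy
    have h2 := hone y hy x hx (Ne.symm hxy)
    have h3 : boundaryDist Ω y x = boundaryDist Ω x y := min_comm _ _
    rw [h3, norm_sub_rev] at h2
    rw [abs_le]
    constructor <;> linarith
  intro x hx y hy hxy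
  -- Nontriviality makes the frontier nonempty, so `infDist` is a genuine distance and not its
  -- default value 0.
  have : Nontrivial (Eucl n) := ⟨x, y, hxy⟩
  have hfr := frontier_nonempty_of_isBounded hΩb ⟨x, hx⟩
  have hpos : ∀ z ∈ Ω, 0 < infDist z (frontier Ω) := by
    intro z hz
    rw [← isClosed_frontier.notMem_iff_infDist_pos hfr, hΩ.frontier_eq]
    exact fun h => h.2 hz
  set d := boundaryDist Ω x y with hd
  have hd0 : 0 < d := lt_min (hpos x hx) (hpos y hy)
  have hdx : d ≤ infDist x (frontier Ω) := min_le_left _ _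
  have hdD : d ≤ D' :=
    (hdx.trans ((infDist_frontier_le_diam hΩb hx hfr).trans hdiam)).trans (le_max_left _ _)
  -- Since d ≤ D', this gives both R ≤ 1 and 2R < d.
  set R := d / (4 * (D' + 1)) with hR
  have hR0 : 0 < R := by positivity
  have hR1 : R ≤ 1 := by rw [hR, div_le_one (by positivity)]; linarith
  have hRd : 2 * R < d := by
    rw [hR, mul_div_assoc', div_lt_iff₀ (by positivity)]
    nlinarith
  have hsub : closedBall x (2 * R) ⊆ Ω :=
    (closedBall_subset_ball (hRd.trans_le hdx)).trans (ball_infDist_frontier_subset hx)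
  have hn : 0 ≤ ‖x - y‖ := norm_nonneg _
  have hgoal : 4 * (D' + 1) * (C + 2 * M' / ε) / d * ‖x - y‖ =
      C / R * ‖x - y‖ + 2 * M' / (ε * R) * ‖x - y‖ := by
    rw [hR]; field_simp
  rw [hgoal]
  by_cases hclose : ‖x - y‖ ≤ ε * R
  · have h1 := hest Ω F u hΩ hF hFz hFs hu x R hR0 hR1 hsub
      (fun z hz => (huM z (hsub hz)).trans (le_max_left _ _)) y hclose
    have h2 : 0 ≤ 2 * M' / (ε * R) * ‖x - y‖ := by positivity
    linarith
  · push Not at hclose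
    have h1 := (abs_le.1 (huM x hx)).2
    have h2 := (abs_le.1 (huM y hy)).1
    have h3 : M ≤ M' := le_max_left _ _
    have h4 : 2 * M' ≤ 2 * M' / (ε * R) * ‖x - y‖ := by
      rw [div_mul_eq_mul_div, le_div_iff₀ (by positivity)]
      gcongr
    have h5 : 0 ≤ C / R * ‖x - y‖ := by positivity
    linarith

end FullyNonlinear

theorem theorem4p2 (n : ℕ) (lam Lam mu β : ℝ) (hlam : 0 < lam) (hLam : lam ≤ Lam)
    (hmu : 0 < mu) (hβ0 : 0 < β) (hβ1 : β ≤ 1) :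
    (∀ (Ω : Set (FullyNonlinear.Eucl n)) (F : FullyNonlinear.Nonlinearity n)
        (u : FullyNonlinear.Eucl n → ℝ),
      IsOpen Ω → Bornology.IsBounded Ω →
      FullyNonlinear.UniformlyElliptic Ω F lam Lam →
      FullyNonlinear.MonotoneInValue Ω F →
      FullyNonlinear.NaturalStructure Ω F mu β →
      FullyNonlinear.IsViscositySolution Ω F u →
      LocallyLipschitzOn Ω u) ∧
    (∀ M D : ℝ, ∃ C : ℝ, 0 < C ∧
      ∀ (Ω : Set (FullyNonlinear.Eucl n)) (F : FullyNonlinear.Nonlinearity n)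
        (u : FullyNonlinear.Eucl n → ℝ),
      IsOpen Ω → Bornology.IsBounded Ω → Metric.diam Ω ≤ D →
      FullyNonlinear.UniformlyElliptic Ω F lam Lam →
      FullyNonlinear.MonotoneInValue Ω F →
      FullyNonlinear.NaturalStructure Ω F mu β →
      FullyNonlinear.IsViscositySolution Ω F u →
      (∀ x ∈ Ω, |u x| ≤ M) →
      ∀ x ∈ Ω, ∀ y ∈ Ω,
        |u x - u y| ≤ C / FullyNonlinear.boundaryDist Ω x y * ‖x - y‖) := by
  exact ⟨fun Ω F u hΩ _ hF hFz hFs hu =>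
    FullyNonlinear.locallyLipschitzOn_of_isViscositySolution hlam hLam hmu hβ0 hβ1 hΩ hF hFz hFs hu,
    FullyNonlinear.exists_global_lipschitz_constant n hlam hLam hmu hβ0 hβ1⟩
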